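/- **Setting.** Let $(A_i,i)$, $i=1,\dots,\kappa$, be prototiles in $\mathbb R^d$: each $A_i$ is a non-empty compact set that is the closure of its interior. A tile of type $i$ is a translate $x+T_i=(x+A_i,i)$ of $T_i=(A_i,i)$; a tiling is a set of tiles whose supports cover $\mathbb R^d$ and have mutually disjoint interiors; a patch is a non-empty finite set of tiles with mutually disjoint interiors, and its support is the union of the supports of its tiles. A tile-substitution $\omega$ with expansive linear map $Q$ is given by finite sets $\mathcal D_{ij}\subset\mathbb R^d$ with $QA_j=\bigcup_{i}(\mathcal D_{ij}+A_i)$ for all $j$, where all the sets $u+A_i$ ($i\le\kappa$, $u\in\mathcal D_{ij}$) have mutually disjoint interiors; here expansive means that $\varrho(Qx,Qy)\ge c\,\varrho(x,y)$ for some $c>1$ and some metric $\varrho$ equivalent to the Euclidean one. One sets $\omega(x+T_j)=\{Qx+u+T_i: i\le\kappa,\ u\in\mathcal D_{ij}\}$ and $\omega(P)=\bigcup_{T\in P}\omega(T)$ for every set $P$ of tiles. The substitution is primitive if some power $\mathsf S^\ell$, $\ell>0$, of the matrix $\mathsf S=(\#\mathcal D_{ij})$ has no zero entries. A tiling $\mathcal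 T$ is a fixed point of $\omega$ if $\omega(\mathcal T)=\mathcal T$. A patch is legal if a translate of it is contained in $\omega^k(T_i)$ for some $k\in\mathbb N$ and some $i$; a non-legal patch that is a limit of legal patches is called admitted in the limit. The space $X_{\mathcal T}$ is the closure of the orbit $\{\mathcal T-g: g\in\mathbb R^d\}$ in the space of all tilings by translates of the given prototiles, with respect to the local rubber metric: two tilings are $\varepsilon$-close if, within the ball of radius $1/\varepsilon$ about the origin, the translation vectors of the tiles of each are within $\varepsilon$ of those of tiles of the same type of the other. A van Hove sequence is a sequence $(F_n)$ of bounded measurable subsets of $\mathbb R^d$ of positive volume such that for every $r>0$ the volume of $\{x:\operatorname{dist}(x,\partial F_n)\le r\}$, divided by $\mathrm{Vol}(F_n)$, tends to $0$. For a patch $P$, a tiling $\mathcal S$ and $F\subset\mathbb R^d$ let $L_P(F,\mathcal S)=\#\{g\in\mathbb R^d: g+P\subset\mathcal S,\ g+\operatorname{supp}P\subset F\}$. The tiling $\mathcal S$ has uniform frequency $\mathrm{freq}(P,\mathcal S)$ of $P$ relative to $(F_n)$ if $L_P(x+F_n,\mathcal S)/\mathrm{Vol}(F_n)\to\mathrm{freq}(P,\mathcal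 S)$ as $n\to\infty$, uniformly in $x\in\mathbb R^d$. **Theorem.** Let $\mathcal T$ be a fixed point of a primitive tile-substitution (finite local complexity is not assumed). (i) For every legal patch $P$, the tiling $\mathcal T$ has a uniform frequency $\mathrm{freq}(P,\mathcal T)>0$ relative to every van Hove sequence, and it does not depend on the van Hove sequence. (ii) For every $\mathcal S\in X_{\mathcal T}$ and every legal patch $P$, the tiling $\mathcal S$ has uniform frequency $\mathrm{freq}(P,\mathcal S)=\mathrm{freq}(P,\mathcal T)>0$ relative to every van Hove sequence. Every non-legal patch, including every patch admitted in the limit, has uniform frequency $0$ in every $\mathcal S\in X_{\mathcal T}$, relative to every van Hove sequence. -/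

import Mathlib

open Set Filter Topology MeasureTheory

noncomputable section

/-- Euclidean space `ℝ^d`. -/
abbrev Euc (d : ℕ) : Type := EuclideanSpace ℝ (Fin d)

/-- A tile `(x + A_i, i)`, a translate of the prototile `(A_i, i)`, is recorded as the pair `(x, i)`
of its translation vector and its type. As prototiles are non-empty and compact, the vector `x`
is determined by the support `x + A_i`. -/
abbrev Tile (d κ : ℕ) : Type := Euc d × Fin κ

/-- The translate `g + P` of a set of tiles. -/
def translateTiles {d κ : ℕ} (g : Euc d) (P : Set (Tile d κ)) : Set (Tile d κ) :=
  (fun t => (g + t.1, t.2)) '' P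

/-- The support `x + A_i` of the tile `(x, i)`. -/
def tileSupport {d κ : ℕ} (A : Fin κ → Set (Euc d)) (t : Tile d κ) : Set (Euc d) :=
  (fun a => t.1 + a) '' A t.2

/-- The support of a set of tiles: the union of the supports of its members. -/
def patchSupport {d κ : ℕ} (A : Fin κ → Set (Euc d)) (P : Set (Tile d κ)) : Set (Euc d) :=
  ⋃ t ∈ P, tileSupport A t

/-- Distinct tiles of `P` have (supports with) disjoint interiors. -/
def InteriorsDisjoint {d κ : ℕ} (A : Fin κ → Set (Euc d)) (P : Set (Tile d κ)) : Prop :=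
  ∀ s ∈ P, ∀ t ∈ P, s ≠ t → Disjoint (interior (tileSupport A s)) (interior (tileSupport A t))

/-- A patch: a finite set of tiles with mutually disjoint interiors. -/
def IsPatch {d κ : ℕ} (A : Fin κ → Set (Euc d)) (P : Set (Tile d κ)) : Prop :=
  P.Finite ∧ InteriorsDisjoint A P

/-- A tiling of `ℝ^d`: a set of tiles with mutually disjoint interiors that covers `ℝ^d`. -/
def IsTiling {d κ : ℕ} (A : Fin κ → Set (Euc d)) (S : Set (Tile d κ)) : Prop :=
  patchSupport A S = univ ∧ InteriorsDisjoint A S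

/-- `Q` is expansive: it expands distances by a factor at least `c > 1` for some metric
that is equivalent to the Euclidean one (induces the same topology). -/
def IsExpansive {d : ℕ} (Q : Euc d →ₗ[ℝ] Euc d) : Prop :=
  ∃ ρ : MetricSpace (Euc d),
    ρ.toUniformSpace.toTopologicalSpace = (inferInstance : TopologicalSpace (Euc d)) ∧
    ∃ c : ℝ, 1 < c ∧ ∀ x y : Euc d, c * ρ.dist x y ≤ ρ.dist (Q x) (Q y)

/-- A tile-substitution with prototiles `(A i, i)`, expansive map `Q` and digit sets `D i j`:
`ω (A j, j) = {(u + A i, i) : u ∈ D i j}` and `Q (A j) = ⋃ i, (D i j + A i)`. -/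
structure TileSubstitution (d κ : ℕ) where
  A : Fin κ → Set (Euc d)
  nonempty : ∀ i, (A i).Nonempty
  isCompact : ∀ i, IsCompact (A i)
  closure_interior : ∀ i, closure (interior (A i)) = A i
  Q : Euc d →ₗ[ℝ] Euc d
  expansive : IsExpansive Q
  D : Fin κ → Fin κ → Finset (Euc d)
  image_eq : ∀ j, Q '' A j = patchSupport A {t : Tile d κ | t.1 ∈ D t.2 j}
  disjoint : ∀ j, InteriorsDisjoint A {t : Tile d κ | t.1 ∈ D t.2 j}

namespace TileSubstitution

variable {d κ : ℕ} (ω : TileSubstitution d κ)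

/-- The substitution matrix, `S i j = #(D i j)`. -/
def matrix : Matrix (Fin κ) (Fin κ) ℕ := Matrix.of fun i j => (ω.D i j).card

/-- Some power `S ^ ℓ`, `ℓ > 0`, of the substitution matrix has no zero entries. -/
def IsPrimitive : Prop := ∃ ℓ : ℕ, 0 < ℓ ∧ ∀ i j, (ω.matrix ^ ℓ) i j ≠ 0

/-- The substitution on sets of tiles: the tile `(x, j)` is replaced by the tiles
`(Q x + u, i)`, `u ∈ D i j`. -/
def subst (P : Set (Tile d κ)) : Set (Tile d κ) :=
  ⋃ t ∈ P, {s : Tile d κ | ∃ u ∈ ω.D s.2 t.2, s.1 = ω.Q t.1 + u}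

/-- `T` is a tiling with `ω(T) = T`. -/
def IsFixedPoint (T : Set (Tile d κ)) : Prop := IsTiling ω.A T ∧ ω.subst T = T

/-- A patch is legal if some translate of it is contained in `ω^k` of a prototile. -/
def IsLegal (P : Set (Tile d κ)) : Prop :=
  ∃ (k : ℕ) (i : Fin κ) (g : Euc d), translateTiles g P ⊆ ω.subst^[k] {((0 : Euc d), i)}

/-- A non-legal patch that is a limit of legal patches: for every `ε > 0` the tiles of `P` are
matched, type by type and up to displacements smaller than `ε`, with those of a legal patch. -/
def IsAdmittedInLimit (P : Set (Tile d κ)) : Prop :=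
  IsPatch ω.A P ∧ ¬ ω.IsLegal P ∧
    ∀ ε : ℝ, 0 < ε → ∃ f : Tile d κ → Tile d κ, InjOn f P ∧ ω.IsLegal (f '' P) ∧
      ∀ t ∈ P, (f t).2 = t.2 ∧ dist (f t).1 t.1 < ε

end TileSubstitution

/-- Inside the ball of radius `1/ε` about the origin, each tile of `S₁` is within `ε` of a
tile of `S₂` of the same type. -/
def RubberSubset {d κ : ℕ} (ε : ℝ) (S₁ S₂ : Set (Tile d κ)) : Prop :=
  ∀ t ∈ S₁, ‖t.1‖ < 1 / ε → ∃ s ∈ S₂, s.2 = t.2 ∧ dist t.1 s.1 < ε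

/-- The local rubber metric: the minimum of `2^(-1/2)` and the infimum of all `ε > 0` such that
`S₁` and `S₂` agree in the ball of radius `1/ε` up to displacements smaller than `ε`
(the infimum over the empty set being `∞`). -/
def rubberDist {d κ : ℕ} (S₁ S₂ : Set (Tile d κ)) : ℝ :=
  sInf ({ε : ℝ | 0 < ε ∧ RubberSubset ε S₂ S₁ ∧ RubberSubset ε S₁ S₂} ∪ {1 / Real.sqrt 2})

/-- The tiling space `X_T`: the closure of the translation orbit of `T`, with respect to the local
rubber metric, in the space of tilings with prototiles `A`. -/
def tilingSpace {d κ : ℕ} (A : Fin κ → Set (Euc d)) (T : Set (Tile d κ)) :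
    Set (Set (Tile d κ)) :=
  {S | IsTiling A S ∧ ∀ ε : ℝ, 0 < ε → ∃ g : Euc d, rubberDist S (translateTiles (-g) T) < ε}

/-- A van Hove sequence of bounded (Lebesgue) measurable sets; `Metric.cthickening r (frontier F)`
is the set of all points at distance at most `r` from the boundary. -/
def IsVanHove {d : ℕ} (F : ℕ → Set (Euc d)) : Prop :=
  (∀ n, Bornology.IsBounded (F n)) ∧ (∀ n, NullMeasurableSet (F n) volume) ∧
  (∀ n, 0 < volume (F n)) ∧
  ∀ r : ℝ, 0 < r →
    Tendsto (fun n => volume (Metric.cthickening r (frontier (F n))) / volume (F n)) atTop (𝓝 0)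

/-- The vectors `g` with `g + P ⊆ S` and `g + supp P ⊆ F`. -/
def occurrences {d κ : ℕ} (A : Fin κ → Set (Euc d)) (P : Set (Tile d κ)) (F : Set (Euc d))
    (S : Set (Tile d κ)) : Set (Euc d) :=
  {g | translateTiles g P ⊆ S ∧ (fun y => g + y) '' patchSupport A P ⊆ F}

/-- `S` has uniform frequency `c` of the patch `P` relative to `F`: the counts
`L_P(x + F_n, S)` are finite, and `L_P(x + F_n, S) / Vol(F_n)` tends to `c` uniformly in `x`. -/
def HasUniformPatchFreq {d κ : ℕ} (A : Fin κ → Set (Euc d)) (F : ℕ → Set (Euc d))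
    (P S : Set (Tile d κ)) (c : ℝ) : Prop :=
  (∀ n x, (occurrences A P ((fun y => x + y) '' F n) S).Finite) ∧
  TendstoUniformly
    (fun (n : ℕ) (x : Euc d) =>
      ((occurrences A P ((fun y => x + y) '' F n) S).ncard : ℝ) / volume.real (F n))
    (fun _ => c) atTop

end

/-! Call `ω^n` of a single tile a supertile of order `n`. A supertile of order `n + m` is tiled by
supertiles of order `n`, so its number of occurrences of `P` is at least the sum of theirs. The
excess consists of occurrences crossing the boundary of some order-`n` supertile. These lie in a
layer of width `diam supp P`, and since each occurrence owns a tile of volume at least `w`, their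
number is bounded by the volume of the layer. This packing bound replaces finite local complexity.

The layers are negligible relative to the supertiles, because prototile boundaries are null
(`volumeReal_frontier`) and `Q^{-n}` shrinks the layer to the boundary (`exists_boundary_bound`).
Hence the densities of `P` in supertiles evolve by averaging, up to errors tending to `0`.
Primitivity makes all weights positive at one step, so the oscillation over types contracts and all
densities tend to one limit `f` (`exists_common_limit`). The minimum over types never decreases and
is eventually positive when `P` is legal, so then `f > 0`; for non-legal `P` every count is zero and
`f = 0`.

If a tiling equals `ω^n` of some tiling for every `n`, any bounded window is filled by order-`n`
supertiles up to a boundary layer (`window_estimate`), whose share vanishes along a van Hove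
sequence. Only volumes enter, so the estimate is uniform in the translation, and `f` depends on `ω`
and `P` alone. Every member of the tiling space is such a tiling, by a compactness argument
(`exists_iterate_subst_eq`). -/

/-! ### Translates and supports of tiles. -/

section Tiles

variable {d κ : ℕ}

lemma mem_translateTiles {g : Euc d} {P : Set (Tile d κ)} {s : Tile d κ} :
    s ∈ translateTiles g P ↔ (s.1 - g, s.2) ∈ P := by
  constructor
  · rintro ⟨t, ht, rfl⟩
    simpa using ht
  · intro h
    exact ⟨_, h, by simp⟩

lemma translateTiles_subset_iff {g : Euc d} {P X : Set (Tile d κ)} :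
    translateTiles g P ⊆ X ↔ ∀ t ∈ P, (g + t.1, t.2) ∈ X :=
  image_subset_iff

lemma translateTiles_add (g h : Euc d) (P : Set (Tile d κ)) :
    translateTiles (g + h) P = translateTiles g (translateTiles h P) := by
  ext s
  simp only [mem_translateTiles]
  rw [sub_sub]

lemma mem_tileSupport {A : Fin κ → Set (Euc d)} {t : Tile d κ} {y : Euc d} :
    y ∈ tileSupport A t ↔ y - t.1 ∈ A t.2 := by
  constructor
  · rintro ⟨a, ha, rfl⟩
    simpa using ha
  · intro h
    exact ⟨_, h, by simp⟩

lemma tileSupport_eq_image (A : Fin κ → Set (Euc d)) (t : Tile d κ) :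
    tileSupport A t = Homeomorph.addLeft t.1 '' A t.2 := rfl

lemma tileSupport_add (A : Fin κ → Set (Euc d)) (g : Euc d) (t : Tile d κ) :
    tileSupport A (g + t.1, t.2) = (fun y => g + y) '' tileSupport A t := by
  ext y
  simp only [mem_tileSupport, mem_image]
  constructor
  · intro h
    exact ⟨y - g, by rwa [sub_sub], by simp⟩
  · rintro ⟨z, hz, rfl⟩
    convert hz using 1
    abel

lemma interior_tileSupport (A : Fin κ → Set (Euc d)) (t : Tile d κ) :
    interior (tileSupport A t) = Homeomorph.addLeft t.1 '' interior (A t.2) := by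
  rw [tileSupport_eq_image, Homeomorph.image_interior]

lemma frontier_tileSupport (A : Fin κ → Set (Euc d)) (t : Tile d κ) :
    frontier (tileSupport A t) = Homeomorph.addLeft t.1 '' frontier (A t.2) := by
  rw [tileSupport_eq_image, Homeomorph.image_frontier]

lemma mem_interior_tileSupport {A : Fin κ → Set (Euc d)} {t : Tile d κ} {y : Euc d} :
    y ∈ interior (tileSupport A t) ↔ y - t.1 ∈ interior (A t.2) := by
  rw [interior_tileSupport]
  constructor
  · rintro ⟨a, ha, rfl⟩
    simpa using ha
  · intro h
    exact ⟨_, h, by simp⟩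

lemma mem_patchSupport {A : Fin κ → Set (Euc d)} {P : Set (Tile d κ)} {y : Euc d} :
    y ∈ patchSupport A P ↔ ∃ t ∈ P, y ∈ tileSupport A t := by
  simp [patchSupport]

lemma InteriorsDisjoint.mono {A : Fin κ → Set (Euc d)} {P R : Set (Tile d κ)}
    (hR : InteriorsDisjoint A R) (h : P ⊆ R) : InteriorsDisjoint A P :=
  fun s hs t ht => hR s (h hs) t (h ht)

lemma InteriorsDisjoint.translateTiles {A : Fin κ → Set (Euc d)} {P : Set (Tile d κ)}
    (hP : InteriorsDisjoint A P) (g : Euc d) : InteriorsDisjoint A (translateTiles g P) := by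
  intro s hs t ht hst
  rw [mem_translateTiles] at hs ht
  have h := hP _ hs _ ht (by
    intro h
    apply hst
    simp only [Prod.mk.injEq, sub_left_inj] at h
    exact Prod.ext h.1 h.2)
  rw [Set.disjoint_left] at h ⊢
  intro y hy hy'
  rw [mem_interior_tileSupport] at hy hy'
  refine h (a := y - g) ?_ ?_ <;> rw [mem_interior_tileSupport]
  · rwa [sub_sub_sub_cancel_right]
  · rwa [sub_sub_sub_cancel_right]

lemma IsTiling.translateTiles {A : Fin κ → Set (Euc d)} {S : Set (Tile d κ)}
    (hS : IsTiling A S) (g : Euc d) : IsTiling A (translateTiles g S) := by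
  refine ⟨eq_univ_of_forall fun y => ?_, hS.2.translateTiles g⟩
  have hy : y - g ∈ patchSupport A S := hS.1 ▸ mem_univ _
  obtain ⟨t, ht, hyt⟩ := mem_patchSupport.1 hy
  refine mem_patchSupport.2 ⟨(g + t.1, t.2), mem_image_of_mem _ ht, ?_⟩
  rw [mem_tileSupport] at hyt ⊢
  rwa [sub_sub] at hyt

/-- A segment from a point of `K` to a point outside `K` meets the boundary of `K`. -/
lemma mem_cthickening_frontier {E : Type*} [NormedAddCommGroup E] [NormedSpace ℝ E]
    {K : Set E} {a b : E} {r : ℝ} (ha : a ∈ K) (hb : b ∉ K) (hr : dist a b ≤ r) :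
    a ∈ Metric.cthickening r (frontier K) := by
  have hpre : IsPreconnected (segment ℝ a b) := (convex_segment a b).isPreconnected
  obtain ⟨z, hz, hzK⟩ : (segment ℝ a b ∩ frontier K).Nonempty := by
    by_contra hne
    rw [not_nonempty_iff_eq_empty] at hne
    have hsub : segment ℝ a b ⊆ interior K ∪ (closure K)ᶜ := by
      intro z hz
      by_contra hz'
      simp only [mem_union, mem_compl_iff, not_or, not_not] at hz'
      exact (hne ▸ (⟨hz, hz'.2, hz'.1⟩ : z ∈ segment ℝ a b ∩ frontier K) : z ∈ (∅ : Set E))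
    have hdisj : segment ℝ a b ∩ (interior K ∩ (closure K)ᶜ) = ∅ := by
      rw [eq_empty_iff_forall_notMem]
      rintro z ⟨-, hz, hz'⟩
      exact hz' (subset_closure (interior_subset hz))
    rcases isPreconnected_iff_subset_of_disjoint.1 hpre _ _ isOpen_interior
      isClosed_closure.isOpen_compl hsub hdisj with h | h
    · exact hb (interior_subset (h (right_mem_segment ℝ a b)))
    · exact h (left_mem_segment ℝ a b) (subset_closure ha)
  refine Metric.mem_cthickening_of_dist_le a z r _ hzK (le_trans ?_ hr)
  have := segment_subset_closedBall_left a b hz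
  rwa [Metric.mem_closedBall, dist_comm] at this

end Tiles

namespace TileSubstitution

variable {d κ : ℕ} (ω : TileSubstitution d κ)

/-! ### Powers of the expansive map. -/

section Expansion

lemma isClosed_A (i : Fin κ) : IsClosed (ω.A i) := (ω.isCompact i).isClosed

lemma nonempty_interior (i : Fin κ) : (interior (ω.A i)).Nonempty := by
  by_contra h
  rw [not_nonempty_iff_eq_empty] at h
  have := ω.closure_interior i
  rw [h, closure_empty] at this
  exact (ω.nonempty i).ne_empty this.symm

lemma Q_injective : Function.Injective ω.Q := by
  obtain ⟨ρ, -, c, hc, h⟩ := ω.expansive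
  intro x y hxy
  have h1 := h x y
  have h0 : ρ.dist (ω.Q x) (ω.Q y) = 0 := by rw [hxy]; exact ρ.dist_self _
  have h2 : 0 ≤ ρ.dist x y := @dist_nonneg _ ρ.toPseudoMetricSpace x y
  exact ρ.eq_of_dist_eq_zero (by nlinarith)

/-- `Q ^ n` as a linear homeomorphism. -/
noncomputable def powEquiv (n : ℕ) : Euc d ≃L[ℝ] Euc d :=
  (LinearEquiv.ofInjectiveEndo (ω.Q ^ n) (by
    rw [Module.End.coe_pow]; exact ω.Q_injective.iterate n)).toContinuousLinearEquiv

lemma powEquiv_apply (n : ℕ) (x : Euc d) : ω.powEquiv n x = ω.Q^[n] x := by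
  simp [powEquiv, Module.End.pow_apply]

lemma powEquiv_zero (x : Euc d) : ω.powEquiv 0 x = x := by simp [powEquiv_apply]

lemma powEquiv_succ (n : ℕ) (x : Euc d) : ω.powEquiv (n + 1) x = ω.Q (ω.powEquiv n x) := by
  simp [powEquiv_apply, Function.iterate_succ_apply']

/-- In the metric `ρ`, `Q^{-n}` contracts distances to `0` by `c^{-n}`. As `ρ` is only topologically
equivalent to the norm, this yields convergence for each point, not yet a norm bound. -/
lemma tendsto_powEquiv_symm (x : Euc d) :
    Tendsto (fun n => (ω.powEquiv n).symm x) atTop (𝓝 0) := by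
  obtain ⟨ρ, htop, c, hc, h⟩ := ω.expansive
  have hiter : ∀ n x, c ^ n * ρ.dist x 0 ≤ ρ.dist (ω.Q^[n] x) 0 := by
    intro n
    induction n with
    | zero => intro x; simp
    | succ n ih =>
      intro x
      have h1 := h (ω.Q^[n] x) 0
      rw [map_zero] at h1
      rw [Function.iterate_succ_apply']
      calc c ^ (n + 1) * ρ.dist x 0 = c * (c ^ n * ρ.dist x 0) := by ring
        _ ≤ c * ρ.dist (ω.Q^[n] x) 0 := by gcongr; exact ih x
        _ ≤ _ := h1
  have hb : ∀ n, ρ.dist ((ω.powEquiv n).symm x) 0 ≤ ρ.dist x 0 * (c⁻¹) ^ n := by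
    intro n
    have h1 := hiter n ((ω.powEquiv n).symm x)
    rw [← powEquiv_apply, ContinuousLinearEquiv.apply_symm_apply] at h1
    rw [inv_pow, ← div_eq_mul_inv, le_div_iff₀ (by positivity)]
    linarith
  have hlim : Tendsto (fun n => ρ.dist x 0 * (c⁻¹) ^ n) atTop (𝓝 0) := by
    simpa using (tendsto_pow_atTop_nhds_zero_of_lt_one (by positivity)
      (inv_lt_one_of_one_lt₀ hc)).const_mul (ρ.dist x 0)
  have key : @Tendsto _ _ (fun n => (ω.powEquiv n).symm x) atTop
      (@nhds _ ρ.toUniformSpace.toTopologicalSpace 0) := by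
    refine (@tendsto_iff_dist_tendsto_zero _ _ ρ.toPseudoMetricSpace _ _ _).2 ?_
    exact squeeze_zero (fun n => @dist_nonneg _ ρ.toPseudoMetricSpace _ _) hb hlim
  rwa [htop] at key

/-- Linearity and finite dimension turn pointwise convergence of `Q^{-n}` on a basis into a uniform
norm bound. -/
lemma exists_contraction_bound : ∃ q : ℕ → ℝ, (∀ n, 0 ≤ q n) ∧ Tendsto q atTop (𝓝 0) ∧
    ∀ n y, ‖y‖ ≤ q n * ‖ω.powEquiv n y‖ := by
  let b := EuclideanSpace.basisFun (Fin d) ℝ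
  refine ⟨fun n => ∑ i, ‖(ω.powEquiv n).symm (b i)‖, fun n => by positivity, ?_, fun n y => ?_⟩
  · have : Tendsto (fun n => ∑ i, ‖(ω.powEquiv n).symm (b i)‖) atTop (𝓝 (∑ _i : Fin d, (0 : ℝ))) :=
      tendsto_finsetSum _ fun i _ => by simpa using (ω.tendsto_powEquiv_symm (b i)).norm
    simpa using this
  · set z := ω.powEquiv n y with hz
    have hy : y = (ω.powEquiv n).symm z := by simp [hz]
    rw [hy]
    conv_lhs => rw [← b.sum_repr z]
    rw [map_sum, Finset.sum_mul]
    refine (norm_sum_le _ _).trans (Finset.sum_le_sum fun i _ => ?_)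
    rw [map_smul, norm_smul, mul_comm]
    gcongr
    have := PiLp.norm_apply_le (b.repr z) i
    rwa [LinearIsometryEquiv.norm_map] at this

end Expansion

/-! ### Iterated substitution and supertiles. -/

section Iteration

lemma mem_subst {P : Set (Tile d κ)} {s : Tile d κ} :
    s ∈ ω.subst P ↔ ∃ t ∈ P, s.1 - ω.Q t.1 ∈ ω.D s.2 t.2 := by
  simp only [subst, mem_iUnion, mem_ofPred_eq, exists_prop]
  refine exists_congr fun t => and_congr_right fun _ => ?_
  constructor
  · rintro ⟨u, hu, h⟩
    rw [h]
    simpa using hu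
  · intro h
    exact ⟨_, h, by simp⟩

lemma subst_mono {P R : Set (Tile d κ)} (h : P ⊆ R) : ω.subst P ⊆ ω.subst R :=
  biUnion_subset_biUnion_left h

lemma iterate_subst_mono (n : ℕ) {P R : Set (Tile d κ)} (h : P ⊆ R) :
    ω.subst^[n] P ⊆ ω.subst^[n] R := by
  induction n with
  | zero => exact h
  | succ n ih =>
    rw [Function.iterate_succ_apply', Function.iterate_succ_apply']
    exact ω.subst_mono ih

lemma mem_iterate_subst {n : ℕ} {P : Set (Tile d κ)} {s : Tile d κ} :
    s ∈ ω.subst^[n] P ↔ ∃ t ∈ P, s ∈ ω.subst^[n] {t} := by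
  induction n generalizing s with
  | zero => simp
  | succ n ih =>
    simp only [Function.iterate_succ_apply', mem_subst]
    constructor
    · rintro ⟨r, hr, h⟩
      obtain ⟨t, ht, hrt⟩ := ih.1 hr
      exact ⟨t, ht, r, hrt, h⟩
    · rintro ⟨t, ht, r, hrt, h⟩
      exact ⟨r, ih.2 ⟨t, ht, hrt⟩, h⟩

lemma subst_translateTiles (g : Euc d) (P : Set (Tile d κ)) :
    ω.subst (translateTiles g P) = translateTiles (ω.Q g) (ω.subst P) := by
  ext s
  simp only [mem_translateTiles, mem_subst]
  constructor
  · rintro ⟨t, ht, h⟩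
    refine ⟨_, ht, ?_⟩
    convert h using 1
    simp only [map_sub]
    abel
  · rintro ⟨t, ht, h⟩
    refine ⟨(g + t.1, t.2), by simpa using ht, ?_⟩
    convert h using 1
    simp only [map_add]
    abel

lemma iterate_subst_translateTiles (n : ℕ) (g : Euc d) (P : Set (Tile d κ)) :
    ω.subst^[n] (translateTiles g P) = translateTiles (ω.powEquiv n g) (ω.subst^[n] P) := by
  induction n with
  | zero => simp [powEquiv_zero]
  | succ n ih =>
    rw [Function.iterate_succ_apply', Function.iterate_succ_apply', ih, subst_translateTiles,
      powEquiv_succ]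

lemma iterate_subst_singleton (n : ℕ) (t : Tile d κ) :
    ω.subst^[n] {t} = translateTiles (ω.powEquiv n t.1) (ω.subst^[n] {((0 : Euc d), t.2)}) := by
  rw [← iterate_subst_translateTiles]
  simp [translateTiles]

lemma finite_subst {P : Set (Tile d κ)} (hP : P.Finite) : (ω.subst P).Finite := by
  refine hP.biUnion fun t _ => ?_
  refine (Set.Finite.biUnion (finite_univ (α := Fin κ)) fun i _ =>
    ((ω.D i t.2).finite_toSet.image fun u => (ω.Q t.1 + u, i))).subset ?_
  rintro s ⟨u, hu, h⟩
  simp only [mem_univ, iUnion_true, mem_iUnion]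
  exact ⟨s.2, u, hu, Prod.ext h.symm rfl⟩

lemma finite_iterate_subst (n : ℕ) {P : Set (Tile d κ)} (hP : P.Finite) :
    (ω.subst^[n] P).Finite := by
  induction n with
  | zero => exact hP
  | succ n ih => rw [Function.iterate_succ_apply']; exact ω.finite_subst ih

lemma patchSupport_subst (P : Set (Tile d κ)) :
    patchSupport ω.A (ω.subst P) = ω.Q '' patchSupport ω.A P := by
  ext y
  simp only [mem_patchSupport, mem_image, mem_subst]
  have himg : ∀ (j : Fin κ) (z : Euc d), z ∈ ω.Q '' ω.A j ↔
      ∃ t : Tile d κ, t.1 ∈ ω.D t.2 j ∧ z ∈ tileSupport ω.A t := by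
    intro j z
    rw [ω.image_eq j, mem_patchSupport]
    rfl
  constructor
  · rintro ⟨s, ⟨t, ht, hu⟩, hy⟩
    obtain ⟨a, ha, hay⟩ := (himg t.2 (y - ω.Q t.1)).2 ⟨(s.1 - ω.Q t.1, s.2), hu, by
      rw [mem_tileSupport] at hy ⊢
      simpa using hy⟩
    refine ⟨t.1 + a, ⟨t, ht, mem_image_of_mem _ ha⟩, ?_⟩
    rw [map_add, hay]
    abel
  · rintro ⟨x, ⟨t, ht, a, ha, rfl⟩, rfl⟩
    obtain ⟨r, hr, hy⟩ := (himg t.2 (ω.Q a)).1 (mem_image_of_mem _ ha)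
    refine ⟨(ω.Q t.1 + r.1, r.2), ⟨t, ht, by simpa using hr⟩, ?_⟩
    rw [mem_tileSupport] at hy ⊢
    simpa using hy

lemma patchSupport_iterate_subst (n : ℕ) (P : Set (Tile d κ)) :
    patchSupport ω.A (ω.subst^[n] P) = ω.powEquiv n '' patchSupport ω.A P := by
  induction n with
  | zero => simp [powEquiv_zero]
  | succ n ih =>
    rw [Function.iterate_succ_apply', patchSupport_subst, ih, image_image]
    simp [powEquiv_succ]

lemma patchSupport_iterate_subst_singleton (n : ℕ) (t : Tile d κ) :
    patchSupport ω.A (ω.subst^[n] {t}) = ω.powEquiv n '' tileSupport ω.A t := by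
  rw [patchSupport_iterate_subst]
  simp [patchSupport]

lemma tileSupport_subset_of_mem_iterate_subst {n : ℕ} {s t : Tile d κ}
    (hs : s ∈ ω.subst^[n] {t}) : tileSupport ω.A s ⊆ ω.powEquiv n '' tileSupport ω.A t := by
  rw [← patchSupport_iterate_subst_singleton]
  exact subset_biUnion_of_mem (u := fun s => tileSupport ω.A s) hs

lemma interior_powEquiv_image (n : ℕ) (K : Set (Euc d)) :
    interior (ω.powEquiv n '' K) = ω.powEquiv n '' interior K :=
  ((ω.powEquiv n).toHomeomorph.image_interior K).symm

lemma frontier_powEquiv_image (n : ℕ) (K : Set (Euc d)) :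
    frontier (ω.powEquiv n '' K) = ω.powEquiv n '' frontier K :=
  ((ω.powEquiv n).toHomeomorph.image_frontier K).symm

/-- Children of the same tile are disjoint by the digit condition; children of different tiles lie
in the images under `Q` of disjoint interiors. -/
lemma interiorsDisjoint_subst {P : Set (Tile d κ)} (hP : InteriorsDisjoint ω.A P) :
    InteriorsDisjoint ω.A (ω.subst P) := by
  have hsub : ∀ t s : Tile d κ, s.1 - ω.Q t.1 ∈ ω.D s.2 t.2 →
      interior (tileSupport ω.A s) ⊆ ω.powEquiv 1 '' interior (tileSupport ω.A t) := by
    intro t s hs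
    rw [← interior_powEquiv_image]
    refine interior_mono (ω.tileSupport_subset_of_mem_iterate_subst ?_)
    exact ω.mem_subst.2 ⟨t, rfl, hs⟩
  intro s hs s' hs' hne
  obtain ⟨t, ht, hu⟩ := ω.mem_subst.1 hs
  obtain ⟨t', ht', hu'⟩ := ω.mem_subst.1 hs'
  by_cases htt : t = t'
  · subst htt
    have h := (ω.disjoint t.2).translateTiles (ω.Q t.1)
    exact h s (by simpa [mem_translateTiles] using hu) s'
      (by simpa [mem_translateTiles] using hu') hne
  · refine Disjoint.mono (hsub t s hu) (hsub t' s' hu') ?_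
    exact (disjoint_image_iff (ω.powEquiv 1).injective).2 (hP t ht t' ht' htt)

lemma interiorsDisjoint_iterate_subst (n : ℕ) {P : Set (Tile d κ)}
    (hP : InteriorsDisjoint ω.A P) : InteriorsDisjoint ω.A (ω.subst^[n] P) := by
  induction n with
  | zero => exact hP
  | succ n ih => rw [Function.iterate_succ_apply']; exact ω.interiorsDisjoint_subst ih

lemma interiorsDisjoint_singleton (t : Tile d κ) : InteriorsDisjoint ω.A {t} := by
  rintro s rfl t rfl h
  exact absurd rfl h

lemma isTiling_iterate_subst (n : ℕ) {S : Set (Tile d κ)} (hS : IsTiling ω.A S) :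
    IsTiling ω.A (ω.subst^[n] S) := by
  refine ⟨?_, ω.interiorsDisjoint_iterate_subst n hS.2⟩
  rw [patchSupport_iterate_subst, hS.1, image_univ]
  exact (ω.powEquiv n).surjective.range_eq

lemma nonempty_interior_tileSupport (t : Tile d κ) : (interior (tileSupport ω.A t)).Nonempty := by
  rw [interior_tileSupport]
  exact (ω.nonempty_interior t.2).image _

lemma closure_interior_tileSupport (t : Tile d κ) :
    closure (interior (tileSupport ω.A t)) = tileSupport ω.A t := by
  rw [interior_tileSupport, ← Homeomorph.image_closure, ω.closure_interior, tileSupport_eq_image]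

lemma isCompact_tileSupport (t : Tile d κ) : IsCompact (tileSupport ω.A t) :=
  (ω.isCompact t.2).image (continuous_const.add continuous_id)

/-- Distinct tiles have disjoint substitution images. -/
lemma eq_of_mem_iterate_subst {n : ℕ} {P : Set (Tile d κ)} (hP : InteriorsDisjoint ω.A P)
    {s t t' : Tile d κ} (ht : t ∈ P) (ht' : t' ∈ P) (hs : s ∈ ω.subst^[n] {t})
    (hs' : s ∈ ω.subst^[n] {t'}) : t = t' := by
  by_contra hne
  obtain ⟨y, hy⟩ := ω.nonempty_interior_tileSupport s
  have h1 := interior_mono (ω.tileSupport_subset_of_mem_iterate_subst hs) hy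
  have h2 := interior_mono (ω.tileSupport_subset_of_mem_iterate_subst hs') hy
  rw [interior_powEquiv_image] at h1 h2
  exact Set.disjoint_left.1
    ((disjoint_image_iff (ω.powEquiv n).injective).2 (hP t ht t' ht' hne)) h1 h2

/-- The interior of a tile misses the support of any other tile. -/
lemma disjoint_interior_tileSupport {s t : Tile d κ}
    (h : Disjoint (interior (tileSupport ω.A s)) (interior (tileSupport ω.A t))) :
    Disjoint (interior (tileSupport ω.A s)) (tileSupport ω.A t) := by
  rw [← ω.closure_interior_tileSupport t]
  exact h.closure_right isOpen_interior

/-- A tiling that is contained in another one is equal to it. -/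
lemma eq_of_isTiling_subset {S R : Set (Tile d κ)} (hS : IsTiling ω.A S) (hR : IsTiling ω.A R)
    (h : S ⊆ R) : S = R := by
  refine h.antisymm fun t ht => ?_
  by_contra hnt
  obtain ⟨y, hy⟩ := ω.nonempty_interior_tileSupport t
  obtain ⟨s, hs, hys⟩ := mem_patchSupport.1 (hS.1 ▸ mem_univ y : y ∈ patchSupport ω.A S)
  have hst : t ≠ s := fun e => hnt (e ▸ hs)
  exact Set.disjoint_left.1 (ω.disjoint_interior_tileSupport (hR.2 t ht s (h hs) hst)) hy hys

lemma exists_mem_iterate_subst (n : ℕ) (i j : Fin κ) (h : (ω.matrix ^ n) i j ≠ 0) :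
    ∃ t ∈ ω.subst^[n] {((0 : Euc d), j)}, t.2 = i := by
  induction n generalizing i with
  | zero =>
    refine ⟨_, rfl, ?_⟩
    by_contra hij
    exact h (by simp [Ne.symm hij])
  | succ n ih =>
    rw [pow_succ', Matrix.mul_apply] at h
    obtain ⟨k, -, hk⟩ := Finset.exists_ne_zero_of_sum_ne_zero h
    obtain ⟨t, ht, htk⟩ := ih k (right_ne_zero_of_mul hk)
    have hD : (ω.D i k).card ≠ 0 := left_ne_zero_of_mul hk
    obtain ⟨u, hu⟩ := Finset.card_pos.1 (Nat.pos_of_ne_zero hD)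
    refine ⟨(ω.Q t.1 + u, i), ?_, rfl⟩
    rw [Function.iterate_succ_apply', mem_subst]
    exact ⟨t, ht, by simpa [htk] using hu⟩

end Iteration

end TileSubstitution

namespace TileSubstitution

variable {d κ : ℕ} (ω : TileSubstitution d κ)

/-! ### Volumes of supertiles and of their boundary layers. -/

section Volume

/-- The inflation factor of the volume, `|det Q|`. -/
noncomputable def inflation : ℝ := |LinearMap.det ω.Q|

lemma inflation_pos : 0 < ω.inflation := by
  have h : LinearMap.det (LinearEquiv.ofInjectiveEndo ω.Q ω.Q_injective : Euc d →ₗ[ℝ] Euc d) ≠ 0 :=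
    (LinearEquiv.isUnit_det' _).ne_zero
  have he : (LinearEquiv.ofInjectiveEndo ω.Q ω.Q_injective : Euc d →ₗ[ℝ] Euc d) = ω.Q :=
    LinearMap.ext fun x => by simp
  rwa [he, ← abs_pos] at h

lemma volumeReal_powEquiv_image (n : ℕ) (K : Set (Euc d)) :
    volume.real (ω.powEquiv n '' K) = ω.inflation ^ n * volume.real K := by
  have h := Measure.addHaar_image_linearMap (volume : Measure (Euc d)) (ω.Q ^ n) K
  have himg : (ω.Q ^ n : Euc d →ₗ[ℝ] Euc d) '' K = ω.powEquiv n '' K :=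
    image_congr fun x _ => by rw [powEquiv_apply, Module.End.pow_apply]
  rw [himg] at h
  rw [measureReal_def, h, map_pow, ENNReal.toReal_mul, ENNReal.toReal_ofReal (abs_nonneg _),
    abs_pow]
  rfl

lemma volume_addLeft_image (x : Euc d) (K : Set (Euc d)) :
    volume (Homeomorph.addLeft x '' K) = volume K := by
  have : Homeomorph.addLeft x '' K = (fun y => -x + y) ⁻¹' K := by
    simp
  rw [this, measure_preimage_add]

lemma volumeReal_tileSupport (t : Tile d κ) :
    volume.real (tileSupport ω.A t) = volume.real (ω.A t.2) := by
  rw [measureReal_def, measureReal_def, tileSupport_eq_image, volume_addLeft_image]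

lemma volumeReal_interior_tileSupport (t : Tile d κ) :
    volume.real (interior (tileSupport ω.A t)) = volume.real (interior (ω.A t.2)) := by
  rw [measureReal_def, measureReal_def, interior_tileSupport, volume_addLeft_image]

lemma volumeReal_frontier_tileSupport (t : Tile d κ) :
    volume.real (frontier (tileSupport ω.A t)) = volume.real (frontier (ω.A t.2)) := by
  rw [measureReal_def, measureReal_def, frontier_tileSupport, volume_addLeft_image]

lemma volumeReal_interior_pos (i : Fin κ) : 0 < volume.real (interior (ω.A i)) := by
  refine ENNReal.toReal_pos (isOpen_interior.measure_pos _ (ω.nonempty_interior i)).ne' ?_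
  exact ((measure_mono interior_subset).trans_lt (ω.isCompact i).measure_lt_top).ne

/-- Stated with interiors because it serves to prove that prototile boundaries are null;
`sum_volumeReal_le` is the version available afterwards. -/
lemma sum_volumeReal_interior_le {R : Finset (Tile d κ)} (hR : InteriorsDisjoint ω.A R)
    (n : ℕ) {E : Set (Euc d)} (hE : volume E ≠ ⊤)
    (h : ∀ t ∈ R, ω.powEquiv n '' interior (tileSupport ω.A t) ⊆ E) :
    ∑ t ∈ R, ω.inflation ^ n * volume.real (interior (ω.A t.2)) ≤ volume.real E := by
  have hd : (R : Set (Tile d κ)).PairwiseDisjoint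
      fun t => ω.powEquiv n '' interior (tileSupport ω.A t) := fun s hs t ht hst =>
    (disjoint_image_iff (ω.powEquiv n).injective).2 (hR s hs t ht hst)
  have hm : ∀ t ∈ R, MeasurableSet (ω.powEquiv n '' interior (tileSupport ω.A t)) := by
    intro t _
    rw [← interior_powEquiv_image]
    exact isOpen_interior.measurableSet
  have hfin : ∀ t ∈ R, volume (ω.powEquiv n '' interior (tileSupport ω.A t)) ≠ ⊤ := fun t ht =>
    ((measure_mono (h t ht)).trans_lt hE.lt_top).ne
  calc ∑ t ∈ R, ω.inflation ^ n * volume.real (interior (ω.A t.2))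
      = ∑ t ∈ R, volume.real (ω.powEquiv n '' interior (tileSupport ω.A t)) := by
        refine Finset.sum_congr rfl fun t _ => ?_
        rw [volumeReal_powEquiv_image, volumeReal_interior_tileSupport]
    _ = volume.real (⋃ t ∈ R, ω.powEquiv n '' interior (tileSupport ω.A t)) :=
        (measureReal_biUnion_finset hd hm hfin).symm
    _ ≤ volume.real E := measureReal_mono (iUnion₂_subset h) hE

lemma exists_tileSupport_bound : ∃ D : ℝ, 0 ≤ D ∧ ∀ t : Tile d κ, ∀ y ∈ tileSupport ω.A t,
    ∀ z ∈ tileSupport ω.A t, dist y z ≤ D := by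
  refine ⟨∑ i, Metric.diam (ω.A i), Finset.sum_nonneg fun i _ => Metric.diam_nonneg, ?_⟩
  rintro t _ ⟨a, ha, rfl⟩ _ ⟨b, hb, rfl⟩
  simp only [dist_add_left]
  exact (Metric.dist_le_diam_of_mem (ω.isCompact t.2).isBounded ha hb).trans
    (Finset.single_le_sum (f := fun i => Metric.diam (ω.A i))
      (fun i _ => Metric.diam_nonneg) (Finset.mem_univ t.2))

/-- Fix a ball in `A j`. Pulled back by `Q^{-n}`, the tile covering the image of the centre has
diameter at most `q n * D`, so for large `n` it lies in the ball. -/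
lemma exists_tile_in_interior (j : Fin κ) : ∃ n, ∃ t ∈ ω.subst^[n] {((0 : Euc d), j)},
    tileSupport ω.A t ⊆ interior (ω.powEquiv n '' ω.A j) := by
  obtain ⟨q, hq0, hq, hqb⟩ := ω.exists_contraction_bound
  obtain ⟨D, hD0, hD⟩ := ω.exists_tileSupport_bound
  obtain ⟨z, hz⟩ := ω.nonempty_interior j
  obtain ⟨r, hr, hball⟩ := Metric.isOpen_iff.1 isOpen_interior z hz
  have hlim : Tendsto (fun n => q n * D) atTop (𝓝 0) := by simpa using hq.mul_const D
  obtain ⟨n, hn⟩ := (hlim.eventually (gt_mem_nhds hr)).exists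
  have hsupp : patchSupport ω.A (ω.subst^[n] {((0 : Euc d), j)}) = ω.powEquiv n '' ω.A j := by
    rw [patchSupport_iterate_subst_singleton]
    simp [tileSupport]
  have hmem : ω.powEquiv n z ∈ patchSupport ω.A (ω.subst^[n] {((0 : Euc d), j)}) := by
    rw [hsupp]
    exact mem_image_of_mem _ (interior_subset hz)
  obtain ⟨t, ht, hzt⟩ := mem_patchSupport.1 hmem
  refine ⟨n, t, ht, fun y hy => ?_⟩
  rw [interior_powEquiv_image]
  refine ⟨(ω.powEquiv n).symm y, hball ?_, by simp⟩
  rw [Metric.mem_ball, dist_eq_norm]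
  refine ((hqb n _).trans ?_).trans_lt hn
  rw [map_sub, ContinuousLinearEquiv.apply_symm_apply, ← dist_eq_norm]
  exact mul_le_mul_of_nonneg_left (hD t y hy _ hzt) (hq0 n)

lemma sum_subst_singleton_interior_le (n : ℕ) (j : Fin κ) {R : Finset (Tile d κ)}
    (hR : (R : Set (Tile d κ)) = ω.subst^[n] {((0 : Euc d), j)}) :
    ∑ t ∈ R, volume.real (interior (ω.A t.2)) ≤
      ω.inflation ^ n * volume.real (interior (ω.A j)) := by
  have hdis : InteriorsDisjoint ω.A (R : Set (Tile d κ)) := by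
    rw [hR]
    exact ω.interiorsDisjoint_iterate_subst n (ω.interiorsDisjoint_singleton _)
  have h := ω.sum_volumeReal_interior_le hdis 0 (E := ω.powEquiv n '' interior (ω.A j)) ?_ ?_
  · rw [volumeReal_powEquiv_image] at h
    simpa using h
  · refine ((measure_mono (image_mono interior_subset)).trans_lt ?_).ne
    exact ((ω.isCompact j).image (ω.powEquiv n).continuous).measure_lt_top
  · rintro t ht _ ⟨y, hy, rfl⟩
    rw [powEquiv_zero, ← interior_powEquiv_image]
    have hsub := ω.tileSupport_subset_of_mem_iterate_subst (hR ▸ Finset.mem_coe.2 ht)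
    have : tileSupport ω.A ((0 : Euc d), j) = ω.A j := by simp [tileSupport]
    rw [this] at hsub
    exact interior_mono hsub hy

/-- The boundaries of the prototiles have measure zero. -/
lemma volumeReal_frontier (i : Fin κ) : volume.real (frontier (ω.A i)) = 0 := by
  classical
  set b : Fin κ → ℝ := fun i => volume.real (frontier (ω.A i)) with hb
  set w : Fin κ → ℝ := fun i => volume.real (interior (ω.A i)) with hw
  have hwpos : ∀ i, 0 < w i := ω.volumeReal_interior_pos
  have hb0 : ∀ i, 0 ≤ b i := fun i => measureReal_nonneg
  have : Nonempty (Fin κ) := ⟨i⟩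
  -- For the type with the largest ratio of boundary to interior volume, inflation gives a strict
  -- loss: the tile `t₀` inside the supertile contributes no outer boundary but takes up volume.
  obtain ⟨j, hj⟩ := Finite.exists_max fun i => b i / w i
  obtain ⟨n, t₀, ht₀, hsub⟩ := ω.exists_tile_in_interior j
  obtain ⟨R, hR⟩ := (ω.finite_iterate_subst n (finite_singleton ((0 : Euc d), j))).exists_finset_coe
  set m := b j / w j with hm
  have hm0 : 0 ≤ m := div_nonneg (hb0 j) (hwpos j).le
  have hble : ∀ i, b i ≤ m * w i := fun i => (div_le_iff₀ (hwpos i)).1 (hj i)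
  have hbj : b j = m * w j := by rw [hm, div_mul_cancel₀ _ (hwpos j).ne']
  have hmem : t₀ ∈ R := by
    rw [← Finset.mem_coe, hR]
    exact ht₀
  -- A boundary point of the supertile lies in some constituent tile, not in `t₀`, and not in the
  -- interior of any tile, as it would then be interior to the supertile.
  have hcov : ω.powEquiv n '' frontier (ω.A j) ⊆
      ⋃ t ∈ R.erase t₀, frontier (tileSupport ω.A t) := by
    rw [← frontier_powEquiv_image]
    intro y hy
    have hclosed : IsClosed (ω.powEquiv n '' ω.A j) :=
      ((ω.isCompact j).image (ω.powEquiv n).continuous).isClosed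
    have hyK : y ∈ ω.powEquiv n '' ω.A j := hclosed.frontier_subset hy
    have hyi : y ∉ interior (ω.powEquiv n '' ω.A j) := hy.2
    have hsupp : patchSupport ω.A (ω.subst^[n] {((0 : Euc d), j)}) = ω.powEquiv n '' ω.A j := by
      rw [patchSupport_iterate_subst_singleton]
      simp [tileSupport]
    rw [← hsupp] at hyK
    obtain ⟨t, ht, hyt⟩ := mem_patchSupport.1 hyK
    have htR : t ∈ R := by
      rw [← Finset.mem_coe, hR]
      exact ht
    refine mem_iUnion₂.2 ⟨t, Finset.mem_erase.2 ⟨?_, htR⟩, subset_closure hyt, fun hyt' => hyi ?_⟩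
    · rintro rfl
      exact hyi (hsub hyt)
    · refine interior_mono ?_ hyt'
      rw [← hsupp]
      exact subset_biUnion_of_mem (u := fun s => tileSupport ω.A s) ht
  have h1 : ω.inflation ^ n * b j ≤ ∑ t ∈ R.erase t₀, b t.2 := by
    rw [hb, ← volumeReal_powEquiv_image]
    refine (measureReal_mono hcov ?_).trans ((measureReal_biUnion_finset_le _ _).trans ?_)
    · refine ((measure_biUnion_finset_le _ _).trans_lt ?_).ne
      refine ENNReal.sum_lt_top.2 fun t _ => ?_
      exact ((measure_mono (ω.isCompact_tileSupport t).isClosed.frontier_subset).trans_lt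
        (ω.isCompact_tileSupport t).measure_lt_top)
    · exact Finset.sum_le_sum fun t _ => (ω.volumeReal_frontier_tileSupport t).le
  have h2 : ∑ t ∈ R.erase t₀, b t.2 ≤ m * ∑ t ∈ R.erase t₀, w t.2 := by
    rw [Finset.mul_sum]
    exact Finset.sum_le_sum fun t _ => hble t.2
  have h3 : ∑ t ∈ R.erase t₀, w t.2 + w t₀.2 = ∑ t ∈ R, w t.2 := Finset.sum_erase_add _ _ hmem
  have h4 := ω.sum_subst_singleton_interior_le n j hR
  -- The bounds combine to `m * λ^n * w j ≤ m * (λ^n * w j - w t₀.2)`, with `λ` the volume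
  -- inflation, which forces `m = 0`.
  have hm' : m = 0 := by
    by_contra hne
    have hmpos : 0 < m := lt_of_le_of_ne hm0 (Ne.symm hne)
    have h5 : ∑ t ∈ R.erase t₀, w t.2 ≤ ω.inflation ^ n * w j - w t₀.2 := by linarith
    have h6 := mul_le_mul_of_nonneg_left h5 hm0
    have h7 := mul_pos hmpos (hwpos t₀.2)
    rw [hbj] at h1
    nlinarith
  have := hble i
  rw [hm', zero_mul] at this
  exact le_antisymm this (hb0 i)

lemma volumeReal_interior (i : Fin κ) : volume.real (interior (ω.A i)) = volume.real (ω.A i) := by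
  have hfin : volume (frontier (ω.A i)) ≠ ⊤ :=
    ((measure_mono (ω.isClosed_A i).frontier_subset).trans_lt (ω.isCompact i).measure_lt_top).ne
  have hn : volume (frontier (ω.A i)) = 0 := by
    have := ω.volumeReal_frontier i
    rwa [measureReal_def, ENNReal.toReal_eq_zero_iff, or_iff_left hfin] at this
  have : volume (interior (ω.A i)) = volume (ω.A i) := by
    rw [← closure_sdiff_interior (ω.A i), (ω.isClosed_A i).closure_eq] at hn
    exact measure_eq_measure_of_null_sdiff interior_subset hn
  rw [measureReal_def, this, measureReal_def]

lemma volumeReal_pos (i : Fin κ) : 0 < volume.real (ω.A i) := by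
  rw [← volumeReal_interior]
  exact ω.volumeReal_interior_pos i

lemma sum_volumeReal_le {R : Finset (Tile d κ)} (hR : InteriorsDisjoint ω.A R)
    (n : ℕ) {E : Set (Euc d)} (hE : volume E ≠ ⊤)
    (h : ∀ t ∈ R, ω.powEquiv n '' tileSupport ω.A t ⊆ E) :
    ∑ t ∈ R, ω.inflation ^ n * volume.real (ω.A t.2) ≤ volume.real E := by
  have := ω.sum_volumeReal_interior_le hR n hE fun t ht =>
    (image_mono interior_subset).trans (h t ht)
  simpa only [volumeReal_interior] using this

lemma volumeReal_le_sum {R : Finset (Tile d κ)} (n : ℕ) {E Z : Set (Euc d)} (hZ : volume Z ≠ ⊤)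
    (h : E ⊆ (⋃ t ∈ R, ω.powEquiv n '' tileSupport ω.A t) ∪ Z) :
    volume.real E ≤ ∑ t ∈ R, ω.inflation ^ n * volume.real (ω.A t.2) + volume.real Z := by
  refine (measureReal_mono h ?_).trans ((measureReal_union_le _ _).trans ?_)
  · refine ((measure_union_le _ _).trans_lt (ENNReal.add_lt_top.2 ⟨?_, hZ.lt_top⟩)).ne
    refine (measure_biUnion_finset_le _ _).trans_lt (ENNReal.sum_lt_top.2 fun t _ => ?_)
    exact ((ω.isCompact_tileSupport t).image (ω.powEquiv n).continuous).measure_lt_top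
  · gcongr
    refine (measureReal_biUnion_finset_le _ _).trans (Finset.sum_le_sum fun t _ => ?_)
    rw [volumeReal_powEquiv_image, volumeReal_tileSupport]

/-- Packing gives one inequality and covering the other; they match because boundaries are null.
This exactness makes the averaging weights sum to one. -/
lemma sum_volumeReal_subst_singleton (m n : ℕ) (j : Fin κ) {R : Finset (Tile d κ)}
    (hR : (R : Set (Tile d κ)) = ω.subst^[m] {((0 : Euc d), j)}) :
    ∑ t ∈ R, ω.inflation ^ n * volume.real (ω.A t.2) =
      ω.inflation ^ (n + m) * volume.real (ω.A j) := by
  have hsupp : patchSupport ω.A (R : Set (Tile d κ)) = ω.powEquiv m '' ω.A j := by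
    rw [hR, patchSupport_iterate_subst_singleton]
    simp [tileSupport]
  rw [← Finset.mul_sum, pow_add, mul_assoc]
  congr 1
  apply le_antisymm
  · simpa only [volumeReal_interior] using ω.sum_subst_singleton_interior_le m j hR
  · rw [← volumeReal_powEquiv_image, ← hsupp]
    have := ω.volumeReal_le_sum (R := R) 0 (E := patchSupport ω.A (R : Set (Tile d κ))) (Z := ∅)
      (by simp) (by simp [patchSupport, powEquiv_zero])
    simpa using this

lemma exists_volumeReal_lower_bound : ∃ w : ℝ, 0 < w ∧ ∀ i, w ≤ volume.real (ω.A i) := by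
  rcases isEmpty_or_nonempty (Fin κ) with h | h
  · exact ⟨1, one_pos, fun i => h.elim i⟩
  · obtain ⟨j, hj⟩ := Finite.exists_min fun i => volume.real (ω.A i)
    exact ⟨_, ω.volumeReal_pos j, hj⟩

lemma card_mul_le {w : ℝ} (hw : ∀ i, w ≤ volume.real (ω.A i)) {R : Finset (Tile d κ)}
    (hR : InteriorsDisjoint ω.A R) {E : Set (Euc d)} (hE : volume E ≠ ⊤)
    (h : ∀ t ∈ R, tileSupport ω.A t ⊆ E) : (R.card : ℝ) * w ≤ volume.real E := by
  have h1 := ω.sum_volumeReal_le hR 0 hE (by simpa [powEquiv_zero] using h)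
  refine le_trans ?_ h1
  rw [← nsmul_eq_mul]
  exact Finset.card_nsmul_le_sum _ _ _ fun t _ => by simpa using hw t.2

lemma finite_of_tileSupport_subset {R : Set (Tile d κ)} (hR : InteriorsDisjoint ω.A R)
    {E : Set (Euc d)} (hE : volume E ≠ ⊤) (h : ∀ t ∈ R, tileSupport ω.A t ⊆ E) : R.Finite := by
  obtain ⟨w, hw0, hw⟩ := ω.exists_volumeReal_lower_bound
  by_contra hinf
  obtain ⟨N, hN⟩ := exists_nat_gt (volume.real E / w)
  obtain ⟨F, hF, hcard⟩ := Set.Infinite.exists_subset_card_eq hinf N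
  have := ω.card_mul_le hw (hR.mono hF) hE fun t ht => h t (hF ht)
  rw [hcard] at this
  rw [div_lt_iff₀ hw0] at hN
  linarith

lemma ncard_mul_le {w : ℝ} (hw : ∀ i, w ≤ volume.real (ω.A i)) {R : Set (Tile d κ)}
    (hR : InteriorsDisjoint ω.A R) {E : Set (Euc d)} (hE : volume E ≠ ⊤)
    (h : ∀ t ∈ R, tileSupport ω.A t ⊆ E) : (R.ncard : ℝ) * w ≤ volume.real E := by
  obtain ⟨F, rfl⟩ := (ω.finite_of_tileSupport_subset hR hE h).exists_finset_coe
  rw [ncard_coe_finset]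
  exact ω.card_mul_le hw hR hE h

lemma cthickening_powEquiv_image {q ρ : ℝ} (hq0 : 0 ≤ q) (hρ : 0 ≤ ρ) (n : ℕ)
    (hq : ∀ y, ‖y‖ ≤ q * ‖ω.powEquiv n y‖) {K : Set (Euc d)} (hK : IsCompact K) :
    Metric.cthickening ρ (ω.powEquiv n '' K) ⊆
      ω.powEquiv n '' Metric.cthickening (q * ρ) K := by
  intro z hz
  rw [(hK.image (ω.powEquiv n).continuous).cthickening_eq_biUnion_closedBall hρ] at hz
  simp only [mem_iUnion, exists_prop, Metric.mem_closedBall] at hz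
  obtain ⟨_, ⟨k, hk, rfl⟩, hzk⟩ := hz
  refine ⟨(ω.powEquiv n).symm z, ?_, by simp⟩
  refine Metric.mem_cthickening_of_dist_le _ k _ _ hk ?_
  rw [dist_eq_norm]
  refine (hq _).trans ?_
  rw [map_sub, ContinuousLinearEquiv.apply_symm_apply, ← dist_eq_norm]
  exact mul_le_mul_of_nonneg_left hzk hq0

/-- Boundary layers of supertiles have negligible volume. -/
lemma exists_boundary_bound {ρ : ℝ} (hρ : 0 ≤ ρ) : ∃ ε : ℕ → ℝ, Tendsto ε atTop (𝓝 0) ∧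
    ∀ n j, volume.real (Metric.cthickening ρ (frontier (ω.powEquiv n '' ω.A j))) ≤
      ε n * (ω.inflation ^ n * volume.real (ω.A j)) := by
  obtain ⟨q, hq0, hq, hqb⟩ := ω.exists_contraction_bound
  have hcomp : ∀ j, IsCompact (frontier (ω.A j)) := fun j =>
    (ω.isCompact j).of_isClosed_subset isClosed_frontier (ω.isClosed_A j).frontier_subset
  have hlim : ∀ j, Tendsto (fun n => volume.real (Metric.cthickening (q n * ρ)
      (frontier (ω.A j))) / volume.real (ω.A j)) atTop (𝓝 0) := by
    intro j
    -- The thickenings of a compact set shrink in measure to the set itself, here the null boundary.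
    have h1 : Tendsto (fun r => volume.real (Metric.cthickening r (frontier (ω.A j)))) (𝓝 0)
        (𝓝 (volume.real (frontier (ω.A j)))) :=
      (ENNReal.tendsto_toReal (hcomp j).measure_lt_top.ne).comp
        (tendsto_measure_cthickening_of_isCompact (hcomp j))
    have h2 : Tendsto (fun n => q n * ρ) atTop (𝓝 0) := by simpa using hq.mul_const ρ
    simpa [volumeReal_frontier] using (h1.comp h2).div_const (volume.real (ω.A j))
  refine ⟨fun n => ∑ j, volume.real (Metric.cthickening (q n * ρ) (frontier (ω.A j))) /
    volume.real (ω.A j), by simpa using tendsto_finsetSum Finset.univ fun j _ => hlim j, ?_⟩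
  intro n j
  have h1 : volume.real (Metric.cthickening ρ (frontier (ω.powEquiv n '' ω.A j))) ≤
      ω.inflation ^ n * volume.real (Metric.cthickening (q n * ρ) (frontier (ω.A j))) := by
    rw [frontier_powEquiv_image, ← volumeReal_powEquiv_image]
    refine measureReal_mono (ω.cthickening_powEquiv_image (hq0 n) hρ n (hqb n) (hcomp j)) ?_
    exact ((hcomp j).cthickening.image (ω.powEquiv n).continuous).measure_lt_top.ne
  refine h1.trans ?_
  have h2 := Finset.single_le_sum (f := fun j => volume.real (Metric.cthickening (q n * ρ)
    (frontier (ω.A j))) / volume.real (ω.A j))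
    (fun i _ => div_nonneg measureReal_nonneg measureReal_nonneg) (Finset.mem_univ j)
  have h3 := (div_le_iff₀ (ω.volumeReal_pos j)).1 h2
  calc _ ≤ ω.inflation ^ n * (_ * volume.real (ω.A j)) :=
        mul_le_mul_of_nonneg_left h3 (pow_nonneg ω.inflation_pos.le n)
    _ = _ := by ring

end Volume

end TileSubstitution

/-! ### Occurrences of a patch in a set of tiles. -/

section Occurrences

variable {d κ : ℕ}

/-- The vectors `g` with `g + P ⊆ X`. -/
def patchOccurrences (P X : Set (Tile d κ)) : Set (Euc d) := {g | translateTiles g P ⊆ X}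

lemma mem_patchOccurrences {P X : Set (Tile d κ)} {g : Euc d} :
    g ∈ patchOccurrences P X ↔ ∀ t ∈ P, (g + t.1, t.2) ∈ X :=
  translateTiles_subset_iff

lemma injective_addTile (p : Tile d κ) :
    Function.Injective fun g : Euc d => ((g + p.1, p.2) : Tile d κ) := by
  intro g h hgh
  simpa using hgh

lemma finite_patchOccurrences {P X : Set (Tile d κ)} (hP : P.Nonempty) (hX : X.Finite) :
    (patchOccurrences P X).Finite := by
  obtain ⟨p, hp⟩ := hP
  refine Set.Finite.of_finite_image (f := fun g : Euc d => ((g + p.1, p.2) : Tile d κ))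
    (hX.subset ?_) (injective_addTile p).injOn
  rintro _ ⟨g, hg, rfl⟩
  exact mem_patchOccurrences.1 hg p hp

lemma patchOccurrences_translateTiles (P X : Set (Tile d κ)) (h : Euc d) :
    patchOccurrences P (translateTiles h X) = (fun g => h + g) '' patchOccurrences P X := by
  ext g
  simp only [mem_patchOccurrences, mem_translateTiles, mem_image]
  constructor
  · intro hg
    refine ⟨g - h, fun t ht => ?_, by simp⟩
    convert hg t ht using 2
    abel
  · rintro ⟨g, hg, rfl⟩ t ht
    convert hg t ht using 2
    abel

lemma ncard_patchOccurrences_translateTiles (P X : Set (Tile d κ)) (h : Euc d) :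
    (patchOccurrences P (translateTiles h X)).ncard = (patchOccurrences P X).ncard := by
  rw [patchOccurrences_translateTiles]
  exact ncard_image_of_injective _ (add_right_injective h)

end Occurrences

namespace TileSubstitution

variable {d κ : ℕ} (ω : TileSubstitution d κ)

/-! ### Counting patches in unions of supertiles. -/

section Counting

/-- The number of occurrences of `P` in the supertile of order `n` and type `j`. -/
noncomputable def supertileCount (P : Set (Tile d κ)) (n : ℕ) (j : Fin κ) : ℕ :=
  (patchOccurrences P (ω.subst^[n] {((0 : Euc d), j)})).ncard

lemma ncard_patchOccurrences_supertile (P : Set (Tile d κ)) (n : ℕ) (t : Tile d κ) :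
    (patchOccurrences P (ω.subst^[n] {t})).ncard = ω.supertileCount P n t.2 := by
  rw [iterate_subst_singleton, ncard_patchOccurrences_translateTiles, supertileCount]

lemma finite_patchOccurrences_supertile {P : Set (Tile d κ)} (hP : P.Nonempty) (n : ℕ)
    (t : Tile d κ) : (patchOccurrences P (ω.subst^[n] {t})).Finite :=
  finite_patchOccurrences hP (ω.finite_iterate_subst n (finite_singleton t))

/-- Occurrences of `P` in `R` that start in the supertile `Y` but are not contained in it. -/
def crossings (P R Y : Set (Tile d κ)) (p : Tile d κ) : Set (Euc d) :=
  {g | g ∈ patchOccurrences P R ∧ (g + p.1, p.2) ∈ Y ∧ g ∉ patchOccurrences P Y}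

lemma isBounded_patchSupport {P : Set (Tile d κ)} (hP : P.Finite) :
    Bornology.IsBounded (patchSupport ω.A P) :=
  (hP.isCompact_biUnion fun t _ => ω.isCompact_tileSupport t).isBounded

lemma exists_patchSupport_bound {P : Set (Tile d κ)} (hP : P.Finite) :
    ∃ ρ : ℝ, 0 ≤ ρ ∧ ∀ y ∈ patchSupport ω.A P, ∀ z ∈ patchSupport ω.A P, dist y z ≤ ρ :=
  ⟨_, Metric.diam_nonneg, fun _ hy _ hz =>
    Metric.dist_le_diam_of_mem (ω.isBounded_patchSupport hP) hy hz⟩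

/-- The supports of different supertiles overlap at most in their boundaries. -/
lemma notMem_of_mem_interior_of_notMem {n : ℕ} {P : Set (Tile d κ)}
    (hP : InteriorsDisjoint ω.A P) {s t : Tile d κ} (ht : t ∈ P) (hs : s ∈ ω.subst^[n] P)
    (hst : s ∉ ω.subst^[n] {t}) {y : Euc d} (hy : y ∈ interior (tileSupport ω.A s)) :
    y ∉ ω.powEquiv n '' tileSupport ω.A t := by
  obtain ⟨t', ht', hst'⟩ := ω.mem_iterate_subst.1 hs
  have hne : t' ≠ t := fun h => hst (h ▸ hst')
  have hy' := interior_mono (ω.tileSupport_subset_of_mem_iterate_subst hst') hy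
  rw [interior_powEquiv_image] at hy'
  have hd := ω.disjoint_interior_tileSupport (hP t' ht' t ht hne)
  exact Set.disjoint_left.1 ((disjoint_image_iff (ω.powEquiv n).injective).2 hd) hy'

/-- Some tile of a crossing occurrence lies in another supertile and so has a point outside this
one, within `ρ` of every point of the tile `g + p`; the segment between them meets the boundary. -/
lemma tileSupport_subset_cthickening_of_mem_crossings {n : ℕ} {P R : Set (Tile d κ)}
    (hR : InteriorsDisjoint ω.A R) {p t : Tile d κ} (hp : p ∈ P) (ht : t ∈ R) {ρ : ℝ}
    (hρ : ∀ y ∈ patchSupport ω.A P, ∀ z ∈ patchSupport ω.A P, dist y z ≤ ρ) {g : Euc d}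
    (hg : g ∈ crossings P (ω.subst^[n] R) (ω.subst^[n] {t}) p) :
    tileSupport ω.A (g + p.1, p.2) ⊆
      Metric.cthickening ρ (frontier (ω.powEquiv n '' tileSupport ω.A t)) := by
  obtain ⟨hgR, hgp, hgt⟩ := hg
  rw [mem_patchOccurrences] at hgR hgt
  push Not at hgt
  obtain ⟨p', hp', hgp'⟩ := hgt
  obtain ⟨b, hb⟩ := ω.nonempty_interior_tileSupport (g + p'.1, p'.2)
  have hbt := ω.notMem_of_mem_interior_of_notMem hR ht (hgR p' hp') hgp' hb
  have hb' := interior_subset hb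
  intro a ha
  refine mem_cthickening_frontier (ω.tileSupport_subset_of_mem_iterate_subst hgp ha) hbt ?_
  rw [tileSupport_add] at ha hb'
  obtain ⟨a, ha, rfl⟩ := ha
  obtain ⟨b, hb', rfl⟩ := hb'
  simp only [dist_add_left]
  exact hρ _ (mem_patchSupport.2 ⟨p, hp, ha⟩) _ (mem_patchSupport.2 ⟨p', hp', hb'⟩)

/-- The number of translates of a tile with disjoint interiors inside a set of finite volume is
finite and bounded by the volume. -/
lemma finite_and_ncard_mul_le {w : ℝ} (hw : ∀ i, w ≤ volume.real (ω.A i))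
    {S : Set (Tile d κ)} (hS : InteriorsDisjoint ω.A S) (p : Tile d κ) {G : Set (Euc d)}
    {E : Set (Euc d)} (hE : volume E ≠ ⊤) (hGS : ∀ g ∈ G, (g + p.1, p.2) ∈ S)
    (hGE : ∀ g ∈ G, tileSupport ω.A (g + p.1, p.2) ⊆ E) :
    G.Finite ∧ (G.ncard : ℝ) * w ≤ volume.real E := by
  have hd : InteriorsDisjoint ω.A ((fun g : Euc d => ((g + p.1, p.2) : Tile d κ)) '' G) :=
    hS.mono (by rintro _ ⟨g, hg, rfl⟩; exact hGS g hg)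
  have hE' : ∀ t ∈ (fun g : Euc d => ((g + p.1, p.2) : Tile d κ)) '' G,
      tileSupport ω.A t ⊆ E := by
    rintro _ ⟨g, hg, rfl⟩
    exact hGE g hg
  refine ⟨(ω.finite_of_tileSupport_subset hd hE hE').of_finite_image
    (injective_addTile p).injOn, ?_⟩
  have := ω.ncard_mul_le hw hd hE hE'
  rwa [ncard_image_of_injective _ (injective_addTile p)] at this

lemma cthickening_frontier_add_image (ρ : ℝ) (x : Euc d) (K : Set (Euc d)) :
    Metric.cthickening ρ (frontier ((fun y => x + y) '' K)) =
      (fun y => x + y) '' Metric.cthickening ρ (frontier K) := by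
  have h1 : frontier ((fun y => x + y) '' K) = (fun y => x + y) '' frontier K :=
    ((Homeomorph.addLeft x).image_frontier K).symm
  have h2 : ∀ z, Metric.infEDist (x + z) ((fun y => x + y) '' frontier K) =
      Metric.infEDist z (frontier K) := fun z =>
    Metric.infEDist_image (IsometryEquiv.addLeft x).isometry
  rw [h1]
  ext z
  simp only [Metric.mem_cthickening_iff, mem_image]
  constructor
  · intro hz
    exact ⟨-x + z, by rwa [← h2, add_neg_cancel_left], by simp⟩
  · rintro ⟨z, hz, rfl⟩
    rwa [h2]

lemma volumeReal_add_image (x : Euc d) (K : Set (Euc d)) :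
    volume.real ((fun y => x + y) '' K) = volume.real K :=
  congrArg ENNReal.toReal (volume_addLeft_image x K)

lemma volumeReal_cthickening_frontier_supertile (ρ : ℝ) (n : ℕ) (t : Tile d κ) :
    volume.real (Metric.cthickening ρ (frontier (ω.powEquiv n '' tileSupport ω.A t))) =
      volume.real (Metric.cthickening ρ (frontier (ω.powEquiv n '' ω.A t.2))) := by
  have h1 : ω.powEquiv n '' tileSupport ω.A t =
      (fun y => ω.powEquiv n t.1 + y) '' (ω.powEquiv n '' ω.A t.2) := by
    simp only [tileSupport, image_image, map_add]
  rw [h1, cthickening_frontier_add_image, volumeReal_add_image]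

lemma isBounded_supertile (n : ℕ) (t : Tile d κ) :
    Bornology.IsBounded (ω.powEquiv n '' tileSupport ω.A t) :=
  ((ω.isCompact_tileSupport t).image (ω.powEquiv n).continuous).isBounded

lemma volume_cthickening_frontier_ne_top {K : Set (Euc d)} (hK : Bornology.IsBounded K) (r : ℝ) :
    volume (Metric.cthickening r (frontier K)) ≠ ⊤ :=
  ((hK.closure.subset frontier_subset_closure).cthickening).measure_lt_top.ne

/-- No occurrence is counted twice, since its tile `g + p` belongs to only one supertile. -/
lemma sum_supertileCount_le {P : Set (Tile d κ)} (hP : P.Nonempty) (n : ℕ)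
    {R : Finset (Tile d κ)} (hR : InteriorsDisjoint ω.A R) :
    ∑ t ∈ R, ω.supertileCount P n t.2 ≤
      (patchOccurrences P (ω.subst^[n] (R : Set (Tile d κ)))).ncard := by
  classical
  obtain ⟨p, hp⟩ := id hP
  have hfin := fun t => ω.finite_patchOccurrences_supertile hP n t
  have hfinR : (patchOccurrences P (ω.subst^[n] (R : Set (Tile d κ)))).Finite :=
    finite_patchOccurrences hP (ω.finite_iterate_subst n R.finite_toSet)
  have hdisj : (R : Set (Tile d κ)).PairwiseDisjoint fun t => (hfin t).toFinset := by
    intro s hs t ht hst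
    rw [Function.onFun, Finset.disjoint_left]
    intro g hg hg'
    rw [Set.Finite.mem_toFinset, mem_patchOccurrences] at hg hg'
    exact hst (ω.eq_of_mem_iterate_subst hR hs ht (hg p hp) (hg' p hp))
  calc ∑ t ∈ R, ω.supertileCount P n t.2 = ∑ t ∈ R, (hfin t).toFinset.card :=
        Finset.sum_congr rfl fun t _ => by
          rw [← ncard_patchOccurrences_supertile, ncard_eq_toFinset_card _ (hfin t)]
    _ = (R.biUnion fun t => (hfin t).toFinset).card := (Finset.card_biUnion hdisj).symm
    _ ≤ hfinR.toFinset.card := by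
        refine Finset.card_le_card fun g hg => ?_
        obtain ⟨t, ht, hgt⟩ := Finset.mem_biUnion.1 hg
        rw [Set.Finite.mem_toFinset, mem_patchOccurrences] at hgt ⊢
        exact fun s hs => ω.iterate_subst_mono n (singleton_subset_iff.2 ht) (hgt s hs)
    _ = _ := (ncard_eq_toFinset_card _ hfinR).symm

/-- Assign each occurrence to the supertile containing its tile `g + p`: it is either contained in
that supertile or a crossing, and crossings are bounded by packing the boundary layer. -/
lemma ncard_patchOccurrences_le {w : ℝ} (hw0 : 0 < w) (hw : ∀ i, w ≤ volume.real (ω.A i))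
    {P : Set (Tile d κ)} (hP : P.Nonempty) {ρ : ℝ}
    (hρ : ∀ y ∈ patchSupport ω.A P, ∀ z ∈ patchSupport ω.A P, dist y z ≤ ρ) (n : ℕ)
    {R : Finset (Tile d κ)} (hR : InteriorsDisjoint ω.A R) :
    ((patchOccurrences P (ω.subst^[n] (R : Set (Tile d κ)))).ncard : ℝ) ≤
      ∑ t ∈ R, ((ω.supertileCount P n t.2 : ℝ) +
        volume.real (Metric.cthickening ρ (frontier (ω.powEquiv n '' ω.A t.2))) / w) := by
  classical
  obtain ⟨p, hp⟩ := id hP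
  have hfin := fun t => ω.finite_patchOccurrences_supertile hP n t
  have hfinR : (patchOccurrences P (ω.subst^[n] (R : Set (Tile d κ)))).Finite :=
    finite_patchOccurrences hP (ω.finite_iterate_subst n R.finite_toSet)
  have hcfin : ∀ t, (crossings P (ω.subst^[n] (R : Set (Tile d κ))) (ω.subst^[n] {t}) p).Finite :=
    fun t => hfinR.subset fun g hg => hg.1
  have hcross : ∀ t ∈ R, ((hcfin t).toFinset.card : ℝ) ≤
      volume.real (Metric.cthickening ρ (frontier (ω.powEquiv n '' ω.A t.2))) / w := by
    intro t ht
    rw [← ncard_eq_toFinset_card _ (hcfin t), le_div_iff₀ hw0,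
      ← volumeReal_cthickening_frontier_supertile]
    exact (ω.finite_and_ncard_mul_le hw (ω.interiorsDisjoint_iterate_subst n hR) p
      (volume_cthickening_frontier_ne_top (ω.isBounded_supertile n t) ρ)
      (fun g hg => mem_patchOccurrences.1 hg.1 p hp) fun g hg =>
        ω.tileSupport_subset_cthickening_of_mem_crossings hR hp ht hρ hg).2
  calc ((patchOccurrences P (ω.subst^[n] (R : Set (Tile d κ)))).ncard : ℝ)
      = (hfinR.toFinset.card : ℝ) := by rw [ncard_eq_toFinset_card _ hfinR]
    _ ≤ ((R.biUnion fun t => (hfin t).toFinset ∪ (hcfin t).toFinset).card : ℝ) := by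
        refine Nat.cast_le.2 (Finset.card_le_card fun g hg => ?_)
        rw [Set.Finite.mem_toFinset] at hg
        obtain ⟨t, ht, hgt⟩ := ω.mem_iterate_subst.1 (mem_patchOccurrences.1 hg p hp)
        refine Finset.mem_biUnion.2 ⟨t, ht, ?_⟩
        rw [Finset.mem_union, Set.Finite.mem_toFinset, Set.Finite.mem_toFinset]
        by_cases h : g ∈ patchOccurrences P (ω.subst^[n] {t})
        · exact Or.inl h
        · exact Or.inr ⟨hg, hgt, h⟩
    _ ≤ ∑ t ∈ R, (((hfin t).toFinset.card : ℝ) + ((hcfin t).toFinset.card : ℝ)) := by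
        refine (Nat.cast_le.2 Finset.card_biUnion_le).trans ?_
        rw [Nat.cast_sum]
        refine Finset.sum_le_sum fun t _ => ?_
        exact_mod_cast Finset.card_union_le _ _
    _ ≤ _ := by
        refine Finset.sum_le_sum fun t ht => add_le_add (le_of_eq ?_) (hcross t ht)
        rw [← ncard_eq_toFinset_card _ (hfin t), ncard_patchOccurrences_supertile]

end Counting

end TileSubstitution

/-! ### Averaging recursions with vanishing errors. -/

section Contraction

/-- Once the errors are below `η`, applying the recursion `k` times leaves at most `r ^ k * B` plus
a geometric series of errors. -/
lemma tendsto_zero_of_contraction {o ε : ℕ → ℝ} {B r : ℝ} {l : ℕ} (ho : ∀ n, 0 ≤ o n)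
    (hB : ∀ n, o n ≤ B) (hr0 : 0 ≤ r) (hr1 : r < 1) (hε : Tendsto ε atTop (𝓝 0))
    (h : ∀ n, o (n + l) ≤ r * o n + ε n) : Tendsto o atTop (𝓝 0) := by
  have key : ∀ η : ℝ, 0 < η → ∀ k : ℕ, ∀ᶠ n in atTop, o n ≤ r ^ k * B + η / (1 - r) := by
    intro η hη k
    have h1r : 0 < 1 - r := by linarith
    induction k with
    | zero =>
      refine Eventually.of_forall fun n => (hB n).trans ?_
      have : 0 < η / (1 - r) := by positivity
      linarith
    | succ k ih =>
      obtain ⟨N, hN⟩ := eventually_atTop.1 (ih.and (hε.eventually (gt_mem_nhds hη)))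
      refine eventually_atTop.2 ⟨N + l, fun n hn => ?_⟩
      obtain ⟨m, rfl⟩ : ∃ m, n = m + l := ⟨n - l, by omega⟩
      obtain ⟨h1, h2⟩ := hN m (by omega)
      have h3 := mul_le_mul_of_nonneg_left h1 hr0
      -- The error term `η / (1 - r)` is the fixed point of `x ↦ r * x + η`, so it is stable under
      -- the induction.
      have h4 : r * (η / (1 - r)) + η = η / (1 - r) := by
        field_simp
        ring
      calc o (m + l) ≤ r * o m + ε m := h m
        _ ≤ r * (r ^ k * B + η / (1 - r)) + η := by linarith
        _ = r ^ (k + 1) * B + (r * (η / (1 - r)) + η) := by ring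
        _ = _ := by rw [h4]
  rw [Metric.tendsto_atTop]
  intro e he
  have h1r : 0 < 1 - r := by linarith
  have hpow : Tendsto (fun k : ℕ => r ^ k * B) atTop (𝓝 0) := by
    simpa using (tendsto_pow_atTop_nhds_zero_of_lt_one hr0 hr1).mul_const B
  obtain ⟨k, hk⟩ := (hpow.eventually (gt_mem_nhds (half_pos he))).exists
  obtain ⟨N, hN⟩ := eventually_atTop.1 (key (e / 3 * (1 - r)) (by positivity) k)
  refine ⟨N, fun n hn => ?_⟩
  have h1 := hN n hn
  rw [mul_div_cancel_right₀ _ h1r.ne'] at h1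
  rw [Real.dist_eq, sub_zero, abs_of_nonneg (ho n)]
  linarith

/-- Quantities that evolve, up to errors tending to zero, by averaging with positive weights
converge to a common limit. -/
lemma exists_common_limit {ι : Type*} [Fintype ι] [Nonempty ι] {x : ℕ → ι → ℝ} {ε : ℕ → ℝ}
    {p : ℕ → ι → ι → ℝ} {B δ : ℝ} {l : ℕ} (hx0 : ∀ n j, 0 ≤ x n j) (hxB : ∀ n j, x n j ≤ B)
    (hε : Tendsto ε atTop (𝓝 0)) (hp0 : ∀ m j i, 0 ≤ p m j i) (hp1 : ∀ m j, ∑ i, p m j i = 1)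
    (hδ : 0 < δ) (hpδ : ∀ j i, δ ≤ p l j i)
    (hlow : ∀ n m j, ∑ i, p m j i * x n i ≤ x (n + m) j)
    (hupp : ∀ n m j, x (n + m) j ≤ ∑ i, p m j i * x n i + ε n) :
    ∃ f, (∀ j, Tendsto (fun n => x n j) atTop (𝓝 f)) ∧ ∀ n a, (∀ j, a ≤ x n j) → a ≤ f := by
  set a : ℕ → ℝ := fun n => ⨅ j, x n j with ha
  set b : ℕ → ℝ := fun n => ⨆ j, x n j with hb
  have hax : ∀ n j, a n ≤ x n j := fun n j => ciInf_le (finite_range (x n)).bddBelow j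
  have hxb : ∀ n j, x n j ≤ b n := fun n j => le_ciSup (finite_range (x n)).bddAbove j
  -- The lower recursion carries no error, so the minimum is monotone; hence it converges, and its
  -- supremum is the limit.
  have hamono : ∀ n m, a n ≤ a (n + m) := by
    intro n m
    refine le_ciInf fun j => le_trans ?_ (hlow n m j)
    calc a n = ∑ i, p m j i * a n := by rw [← Finset.sum_mul, hp1, one_mul]
      _ ≤ _ := Finset.sum_le_sum fun i _ => mul_le_mul_of_nonneg_left (hax n i) (hp0 m j i)
  have hmono : Monotone a := monotone_nat_of_le_succ fun n => hamono n 1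
  obtain ⟨j₀⟩ := id ‹Nonempty ι›
  have habdd : BddAbove (range a) := ⟨B, by
    rintro _ ⟨n, rfl⟩
    exact (hax n j₀).trans (hxB n j₀)⟩
  have halim := tendsto_atTop_ciSup hmono habdd
  have hδ1 : δ ≤ 1 := by
    rw [← hp1 l j₀]
    exact (hpδ j₀ j₀).trans (Finset.single_le_sum (fun i _ => hp0 l j₀ i) (Finset.mem_univ j₀))
  -- After `l` steps every average gives weight at least `δ` to the index `i₀` of the minimum, which
  -- lowers the maximum by `δ` times the oscillation, up to the error.
  have hosc : ∀ n, b (n + l) - a (n + l) ≤ (1 - δ) * (b n - a n) + ε n := by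
    intro n
    obtain ⟨i₀, hi₀⟩ := exists_eq_ciInf_of_finite (f := x n)
    have hb' : b (n + l) ≤ b n - δ * (b n - a n) + ε n := by
      refine ciSup_le fun j => (hupp n l j).trans (add_le_add_left ?_ _)
      have h1 : ∑ i, p l j i * (b n - x n i) = b n - ∑ i, p l j i * x n i := by
        simp only [mul_sub, Finset.sum_sub_distrib]
        rw [← Finset.sum_mul, hp1, one_mul]
      have h2 : δ * (b n - a n) ≤ ∑ i, p l j i * (b n - x n i) := by
        refine le_trans ?_ (Finset.single_le_sum (f := fun i => p l j i * (b n - x n i))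
          (fun i _ => mul_nonneg (hp0 l j i) (sub_nonneg.2 (hxb n i))) (Finset.mem_univ i₀))
        have h3 : x n i₀ = a n := hi₀
        simp only [h3]
        exact mul_le_mul_of_nonneg_right (hpδ j i₀)
          (sub_nonneg.2 ((hax n i₀).trans (hxb n i₀)))
      linarith
    have := hamono n l
    linarith
  have ho : Tendsto (fun n => b n - a n) atTop (𝓝 0) := by
    refine tendsto_zero_of_contraction (B := B) (r := 1 - δ) (l := l)
      (fun n => sub_nonneg.2 ((hax n j₀).trans (hxb n j₀))) (fun n => ?_)
      (by linarith) (by linarith) hε hosc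
    have h1 : b n ≤ B := ciSup_le fun j => hxB n j
    have h2 : 0 ≤ a n := le_ciInf fun j => hx0 n j
    linarith
  refine ⟨⨆ n, a n, fun j => ?_, fun n c hc => ?_⟩
  · refine tendsto_of_tendsto_of_tendsto_of_le_of_le halim (h := b) ?_ (fun n => hax n j)
      fun n => hxb n j
    simpa using ho.add halim
  · exact (le_ciInf hc).trans (le_ciSup habdd n)

end Contraction

namespace TileSubstitution

variable {d κ : ℕ} (ω : TileSubstitution d κ)

/-! ### Limiting patch densities in supertiles. -/

section SupertileFrequency

lemma finite_of_isLegal {P : Set (Tile d κ)} (hP : ω.IsLegal P) : P.Finite := by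
  obtain ⟨k, i, g, h⟩ := hP
  have hfin := (ω.finite_iterate_subst k (finite_singleton ((0 : Euc d), i))).subset h
  refine hfin.of_finite_image fun s _ t _ hst => ?_
  simp only [Prod.mk.injEq, add_right_inj] at hst
  exact Prod.ext hst.1 hst.2

lemma supertileCount_eq_zero {P : Set (Tile d κ)} (hP : ¬ ω.IsLegal P) (n : ℕ) (j : Fin κ) :
    ω.supertileCount P n j = 0 := by
  have : patchOccurrences P (ω.subst^[n] {((0 : Euc d), j)}) = ∅ :=
    eq_empty_of_forall_notMem fun g hg => hP ⟨n, j, g, hg⟩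
  rw [supertileCount, this, ncard_empty]

/-- The patch sits in `ω^k` of a tile of type `i`, and by primitivity such a tile occurs in `ω^l` of
every type; so order `k + l` serves for all `j`. -/
lemma exists_supertileCount_pos (hω : ω.IsPrimitive) {P : Set (Tile d κ)} (hP : P.Nonempty)
    (hL : ω.IsLegal P) : ∃ n, ∀ j, 0 < ω.supertileCount P n j := by
  obtain ⟨l, -, hl⟩ := hω
  obtain ⟨k, i, g, hg⟩ := hL
  refine ⟨k + l, fun j => ?_⟩
  obtain ⟨t, ht, rfl⟩ := ω.exists_mem_iterate_subst l i j (hl i j)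
  refine (ncard_pos (ω.finite_patchOccurrences_supertile hP _ _)).2
    ⟨ω.powEquiv k t.1 + g, ?_⟩
  have h1 : ω.subst^[k] {t} ⊆ ω.subst^[k + l] {((0 : Euc d), j)} := by
    rw [Function.iterate_add_apply]
    exact ω.iterate_subst_mono k (singleton_subset_iff.2 ht)
  refine Subset.trans ?_ h1
  rw [iterate_subst_singleton, translateTiles_add]
  exact image_mono hg

/-- The density of occurrences of `P` in the supertiles of order `n`. -/
noncomputable def supertileFreq (P : Set (Tile d κ)) (n : ℕ) (j : Fin κ) : ℝ :=
  ω.supertileCount P n j / (ω.inflation ^ n * volume.real (ω.A j))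

lemma inflation_mul_volumeReal_pos (n : ℕ) (j : Fin κ) :
    0 < ω.inflation ^ n * volume.real (ω.A j) :=
  mul_pos (pow_pos ω.inflation_pos n) (ω.volumeReal_pos j)

lemma supertileFreq_mul (P : Set (Tile d κ)) (n : ℕ) (j : Fin κ) :
    ω.supertileFreq P n j * (ω.inflation ^ n * volume.real (ω.A j)) = ω.supertileCount P n j :=
  div_mul_cancel₀ _ (ω.inflation_mul_volumeReal_pos n j).ne'

lemma supertileFreq_le {w : ℝ} (hw0 : 0 < w) (hw : ∀ i, w ≤ volume.real (ω.A i))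
    {P : Set (Tile d κ)} (hP : P.Nonempty) (n : ℕ) (j : Fin κ) :
    ω.supertileFreq P n j ≤ w⁻¹ := by
  obtain ⟨p, hp⟩ := hP
  have hA : tileSupport ω.A ((0 : Euc d), j) = ω.A j := by simp [tileSupport]
  have h := (ω.finite_and_ncard_mul_le hw
    (ω.interiorsDisjoint_iterate_subst n (ω.interiorsDisjoint_singleton ((0 : Euc d), j))) p
    (ω.isBounded_supertile n ((0 : Euc d), j)).measure_lt_top.ne
    (fun g hg => mem_patchOccurrences.1 hg p hp) fun g hg =>
      ω.tileSupport_subset_of_mem_iterate_subst (mem_patchOccurrences.1 hg p hp)).2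
  rw [hA, volumeReal_powEquiv_image] at h
  rw [supertileFreq, div_le_iff₀ (ω.inflation_mul_volumeReal_pos n j), inv_mul_eq_div,
    le_div_iff₀ hw0]
  exact h

/-- The densities of a patch in the supertiles of all types have a common limit. -/
lemma exists_supertileFreq_limit [Nonempty (Fin κ)] (hω : ω.IsPrimitive) {P : Set (Tile d κ)}
    (hP : P.Nonempty) (hPfin : P.Finite) :
    ∃ f, (∀ j, Tendsto (fun n => ω.supertileFreq P n j) atTop (𝓝 f)) ∧
      (ω.IsLegal P → 0 < f) := by
  classical
  obtain ⟨l, -, hl⟩ := id hω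
  obtain ⟨w, hw0, hw⟩ := ω.exists_volumeReal_lower_bound
  obtain ⟨ρ, hρ0, hρ⟩ := ω.exists_patchSupport_bound hPfin
  obtain ⟨ε, hε, hεb⟩ := ω.exists_boundary_bound hρ0
  choose R hR using fun (m : ℕ) (j : Fin κ) =>
    (ω.finite_iterate_subst m (finite_singleton ((0 : Euc d), j))).exists_finset_coe
  have hRd : ∀ m j, InteriorsDisjoint ω.A (R m j : Set (Tile d κ)) := fun m j => by
    rw [hR]
    exact ω.interiorsDisjoint_iterate_subst m (ω.interiorsDisjoint_singleton _)
  have hv := ω.inflation_mul_volumeReal_pos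
  -- The volume occupied by tiles of type `i` in the supertile of order `m` and type `j`; the
  -- averaging weights are its fractions of the total.
  set c : ℕ → Fin κ → Fin κ → ℝ := fun m j i =>
    ∑ t ∈ R m j with t.2 = i, volume.real (ω.A t.2) with hc
  have hcsum : ∀ m j (φ : Fin κ → ℝ), ∑ t ∈ R m j, φ t.2 * volume.real (ω.A t.2) =
      ∑ i, φ i * c m j i := by
    intro m j φ
    rw [← Finset.sum_fiberwise (R m j) (fun t => t.2)]
    refine Finset.sum_congr rfl fun i _ => ?_
    rw [hc, Finset.mul_sum]
    refine Finset.sum_congr rfl fun t ht => ?_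
    rw [(Finset.mem_filter.1 ht).2]
  have hctot : ∀ m j, ∑ i, c m j i = ω.inflation ^ m * volume.real (ω.A j) := by
    intro m j
    have h1 := hcsum m j fun _ => 1
    have h2 := ω.sum_volumeReal_subst_singleton m 0 j (hR m j)
    simp only [pow_zero, one_mul, zero_add] at h1 h2
    rw [← h1, h2]
  obtain ⟨jm, hjm⟩ := Finite.exists_max fun j => volume.real (ω.A j)
  -- Inflating by `Q^n` multiplies all volumes alike, so the same weights, independent of `n`,
  -- describe the division of an order-`n + m` supertile into order-`n` ones.
  have hlink : ∀ n m j (y : Fin κ → ℝ),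
      ∑ t ∈ R m j, y t.2 * (ω.inflation ^ n * volume.real (ω.A t.2)) =
      (∑ i, c m j i / (ω.inflation ^ m * volume.real (ω.A j)) * y i) *
        (ω.inflation ^ (n + m) * volume.real (ω.A j)) := by
    intro n m j y
    have h1 := hcsum m j fun i => y i * ω.inflation ^ n
    simp only [mul_assoc] at h1
    rw [h1, Finset.sum_mul]
    refine Finset.sum_congr rfl fun i _ => ?_
    have h2 := (hv m j).ne'
    rw [pow_add, div_mul_eq_mul_div, div_mul_eq_mul_div, eq_div_iff h2]
    ring
  suffices h : ∃ f, (∀ j, Tendsto (fun n => ω.supertileFreq P n j) atTop (𝓝 f)) ∧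
      ∀ n a, (∀ j, a ≤ ω.supertileFreq P n j) → a ≤ f by
    obtain ⟨f, hf, hfpos⟩ := h
    refine ⟨f, hf, fun hL => ?_⟩
    obtain ⟨n, hn⟩ := ω.exists_supertileCount_pos hω hP hL
    obtain ⟨j, hj⟩ := Finite.exists_min (ω.supertileFreq P n)
    exact (div_pos (Nat.cast_pos.2 (hn j)) (hv n j)).trans_le (hfpos n _ hj)
  -- For `δ`: by primitivity each type fills volume at least `w` in each supertile of order `l`, and
  -- type `jm` gives the largest of these.
  refine exists_common_limit (x := ω.supertileFreq P) (ε := fun n => ε n / w)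
    (p := fun m j i => c m j i / (ω.inflation ^ m * volume.real (ω.A j))) (B := w⁻¹)
    (δ := w / (ω.inflation ^ l * volume.real (ω.A jm))) (l := l)
    (fun n j => div_nonneg (Nat.cast_nonneg _) (hv n j).le)
    (fun n j => ω.supertileFreq_le hw0 hw hP n j)
    (by simpa using hε.div_const w)
    (fun m j i => div_nonneg (Finset.sum_nonneg fun t _ => measureReal_nonneg) (hv m j).le)
    (fun m j => by rw [← Finset.sum_div, hctot, div_self (hv m j).ne'])
    (div_pos hw0 (hv l jm))
    (fun j i => ?_) (fun n m j => ?_) (fun n m j => ?_)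
  · obtain ⟨t, ht, hti⟩ := ω.exists_mem_iterate_subst l i j (hl i j)
    have hmem : t ∈ (R l j).filter fun t => t.2 = i :=
      Finset.mem_filter.2 ⟨by rw [← Finset.mem_coe, hR]; exact ht, hti⟩
    have h1 : w ≤ c l j i := (hw t.2).trans
      (Finset.single_le_sum (f := fun t : Tile d κ => volume.real (ω.A t.2))
        (fun _ _ => measureReal_nonneg) hmem)
    refine div_le_div₀ (hw0.le.trans h1) h1 (hv l j) ?_
    exact mul_le_mul_of_nonneg_left (hjm j) (pow_pos ω.inflation_pos l).le
  · have h1 := ω.sum_supertileCount_le hP n (hRd m j)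
    rw [hR, ← Function.iterate_add_apply] at h1
    have h2 : (∑ t ∈ R m j, (ω.supertileCount P n t.2 : ℝ)) ≤ ω.supertileCount P (n + m) j := by
      exact_mod_cast h1
    simp only [← supertileFreq_mul, hlink] at h2
    exact le_of_mul_le_mul_right h2 (hv _ j)
  · have h1 := ω.ncard_patchOccurrences_le hw0 hw hP hρ n (hRd m j)
    rw [hR, ← Function.iterate_add_apply] at h1
    have h2 : (ω.supertileCount P (n + m) j : ℝ) ≤ ∑ t ∈ R m j,
        (ω.supertileFreq P n t.2 + ε n / w) * (ω.inflation ^ n * volume.real (ω.A t.2)) := by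
      refine h1.trans (Finset.sum_le_sum fun t _ => ?_)
      rw [add_mul, supertileFreq_mul, div_mul_eq_mul_div]
      gcongr
      exact hεb n t.2
    rw [hlink n m j fun i => ω.supertileFreq P n i + ε n / w, ← supertileFreq_mul] at h2
    refine (le_of_mul_le_mul_right h2 (hv _ j)).trans (le_of_eq ?_)
    simp only [mul_add, Finset.sum_add_distrib]
    rw [← Finset.sum_mul, ← Finset.sum_div, hctot, div_self (hv m j).ne', one_mul]

end SupertileFrequency

end TileSubstitution

namespace TileSubstitution

variable {d κ : ℕ} (ω : TileSubstitution d κ)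

/-! ### From supertiles to arbitrary windows. -/

section Windows

lemma exists_supertile_bound (n : ℕ) : ∃ D : ℝ, 0 ≤ D ∧ ∀ t : Tile d κ,
    ∀ y ∈ ω.powEquiv n '' tileSupport ω.A t, ∀ z ∈ ω.powEquiv n '' tileSupport ω.A t,
      dist y z ≤ D := by
  obtain ⟨D, hD0, hD⟩ := ω.exists_tileSupport_bound
  refine ⟨‖(ω.powEquiv n : Euc d →L[ℝ] Euc d)‖ * D, by positivity, ?_⟩
  rintro t _ ⟨y, hy, rfl⟩ _ ⟨z, hz, rfl⟩
  rw [dist_eq_norm, ← map_sub]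
  refine ((ω.powEquiv n : Euc d →L[ℝ] Euc d).le_opNorm _).trans ?_
  rw [← dist_eq_norm]
  gcongr
  exact hD t y hy z hz

lemma finite_supertiles_subset {U : Set (Tile d κ)} (hU : InteriorsDisjoint ω.A U) (n : ℕ)
    {W : Set (Euc d)} (hW : Bornology.IsBounded W) :
    {t ∈ U | ω.powEquiv n '' tileSupport ω.A t ⊆ W}.Finite := by
  refine ω.finite_of_tileSupport_subset (E := (ω.powEquiv n).symm '' W)
    (hU.mono (sep_subset _ _))
    ((ω.powEquiv n).symm.lipschitz.isBounded_image hW).measure_lt_top.ne fun t ht y hy => ?_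
  exact ⟨_, ht.2 (mem_image_of_mem _ hy), by simp⟩

/-- If `S` is tiled by supertiles of order `n`, the patch count in a bounded window is determined by
the counts in the supertiles, up to boundary terms. -/
lemma window_estimate {P : Set (Tile d κ)} (hP : P.Nonempty) {S U : Set (Tile d κ)} {n : ℕ}
    (hU : IsTiling ω.A U) (hUS : ω.subst^[n] U = S) {w ρ D η ε f : ℝ} (hw0 : 0 < w)
    (hw : ∀ i, w ≤ volume.real (ω.A i))
    (hρ : ∀ y ∈ patchSupport ω.A P, ∀ z ∈ patchSupport ω.A P, dist y z ≤ ρ) (hρ0 : 0 ≤ ρ)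
    (hD : ∀ t : Tile d κ, ∀ y ∈ ω.powEquiv n '' tileSupport ω.A t,
      ∀ z ∈ ω.powEquiv n '' tileSupport ω.A t, dist y z ≤ D)
    (hη0 : 0 ≤ η) (hε0 : 0 ≤ ε) (hf0 : 0 ≤ f)
    (hη : ∀ j, |ω.supertileFreq P n j - f| ≤ η)
    (hε : ∀ j, volume.real (Metric.cthickening ρ (frontier (ω.powEquiv n '' ω.A j))) ≤
      ε * (ω.inflation ^ n * volume.real (ω.A j)))
    {W : Set (Euc d)} (hW : Bornology.IsBounded W) :
    (occurrences ω.A P W S).Finite ∧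
      |((occurrences ω.A P W S).ncard : ℝ) - f * volume.real W| ≤ (η + ε / w) * volume.real W +
        (f + w⁻¹) * volume.real (Metric.cthickening (ρ + D) (frontier W)) := by
  obtain ⟨p, hp⟩ := id hP
  -- `I` indexes the supertiles lying inside the window; every other one has a point outside `W`.
  obtain ⟨I, hI⟩ := (ω.finite_supertiles_subset hU.2 n hW).exists_finset_coe
  have hIU : (I : Set (Tile d κ)) ⊆ U := hI ▸ sep_subset _ _
  have hIW : ∀ t ∈ I, ω.powEquiv n '' tileSupport ω.A t ⊆ W := fun t ht =>
    (hI ▸ Finset.mem_coe.2 ht : t ∈ {t ∈ U | ω.powEquiv n '' tileSupport ω.A t ⊆ W}).2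
  have hnotI : ∀ t ∈ U, t ∉ I → ∃ z ∈ ω.powEquiv n '' tileSupport ω.A t, z ∉ W := by
    intro t ht htI
    rw [← Finset.mem_coe, hI] at htI
    exact not_subset.1 fun h => htI ⟨ht, h⟩
  have hId : InteriorsDisjoint ω.A (I : Set (Tile d κ)) := hU.2.mono hIU
  have hSd : InteriorsDisjoint ω.A S := hUS ▸ ω.interiorsDisjoint_iterate_subst n hU.2
  set Z := Metric.cthickening (ρ + D) (frontier W) with hZ
  have hZfin : volume Z ≠ ⊤ := volume_cthickening_frontier_ne_top hW _
  set V := ∑ t ∈ I, ω.inflation ^ n * volume.real (ω.A t.2) with hV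
  have hV0 : 0 ≤ V := Finset.sum_nonneg fun t _ => (ω.inflation_mul_volumeReal_pos n t.2).le
  have hV1 : V ≤ volume.real W := ω.sum_volumeReal_le hId n hW.measure_lt_top.ne hIW
  have hV2 : volume.real W ≤ V + volume.real Z := by
    refine ω.volumeReal_le_sum n hZfin fun y hy => ?_
    have hy' : y ∈ ω.powEquiv n '' patchSupport ω.A U := by
      rw [hU.1, image_univ, (ω.powEquiv n).surjective.range_eq]
      trivial
    obtain ⟨x, hx, rfl⟩ := hy'
    obtain ⟨t, ht, hxt⟩ := mem_patchSupport.1 hx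
    by_cases htI : t ∈ I
    · exact Or.inl (mem_iUnion₂.2 ⟨t, htI, mem_image_of_mem _ hxt⟩)
    · obtain ⟨z, hz, hzW⟩ := hnotI t ht htI
      refine Or.inr (mem_cthickening_frontier hy hzW ?_)
      linarith [hD t _ (mem_image_of_mem _ hxt) z hz]
  set O := patchOccurrences P (ω.subst^[n] (I : Set (Tile d κ))) with hO
  have hOfin : O.Finite := finite_patchOccurrences hP (ω.finite_iterate_subst n I.finite_toSet)
  set G := {g ∈ occurrences ω.A P W S | g ∉ O} with hG
  -- Such an occurrence has a tile in a supertile that leaves `W`. A path of length `ρ` inside the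
  -- patch and then `D` inside the supertile leads out of `W`, whence the width `ρ + D`.
  have hGZ : ∀ g ∈ G, tileSupport ω.A (g + p.1, p.2) ⊆ Z := by
    rintro g ⟨hgW, hgO⟩ y hy
    rw [hO, mem_patchOccurrences] at hgO
    push Not at hgO
    obtain ⟨p', hp', hgp'⟩ := hgO
    have hgS := mem_patchOccurrences.1 hgW.1 p' hp'
    rw [← hUS] at hgS
    obtain ⟨t, ht, hgt⟩ := ω.mem_iterate_subst.1 hgS
    have htI : t ∉ I := fun h =>
      hgp' (ω.iterate_subst_mono n (singleton_subset_iff.2 (Finset.mem_coe.2 h)) hgt)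
    obtain ⟨z, hz, hzW⟩ := hnotI t ht htI
    obtain ⟨b, hb⟩ := ω.nonempty_interior_tileSupport (g + p'.1, p'.2)
    have hb' := interior_subset hb
    have hbz := hD t b (ω.tileSupport_subset_of_mem_iterate_subst hgt hb') z hz
    rw [tileSupport_add] at hy hb'
    obtain ⟨y, hy, rfl⟩ := hy
    obtain ⟨b, hb', rfl⟩ := hb'
    have hyP : y ∈ patchSupport ω.A P := mem_patchSupport.2 ⟨p, hp, hy⟩
    have hyb := hρ y hyP b (mem_patchSupport.2 ⟨p', hp', hb'⟩)
    refine mem_cthickening_frontier (hgW.2 (mem_image_of_mem _ hyP)) hzW ?_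
    refine (dist_triangle _ (g + b) _).trans ?_
    rw [dist_add_left]
    linarith
  obtain ⟨hGfin, hGcard⟩ := ω.finite_and_ncard_mul_le hw hSd p hZfin
    (fun g hg => mem_patchOccurrences.1 hg.1.1 p hp) hGZ
  have hsub : occurrences ω.A P W S ⊆ O ∪ G := fun g hg => by
    by_cases h : g ∈ O
    · exact Or.inl h
    · exact Or.inr ⟨hg, h⟩
  have hfin : (occurrences ω.A P W S).Finite := (hOfin.union hGfin).subset hsub
  have hOsub : O ⊆ occurrences ω.A P W S := by
    intro g hg
    rw [hO, mem_patchOccurrences] at hg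
    refine ⟨mem_patchOccurrences.2 fun t ht => ?_, ?_⟩
    · rw [← hUS]
      exact ω.iterate_subst_mono n hIU (hg t ht)
    · rintro _ ⟨y, hy, rfl⟩
      obtain ⟨t, ht, hyt⟩ := mem_patchSupport.1 hy
      obtain ⟨s, hs, hgs⟩ := ω.mem_iterate_subst.1 (hg t ht)
      refine hIW s hs (ω.tileSupport_subset_of_mem_iterate_subst hgs ?_)
      rw [tileSupport_add]
      exact mem_image_of_mem _ hyt
  refine ⟨hfin, ?_⟩
  have hL1 : (O.ncard : ℝ) ≤ (occurrences ω.A P W S).ncard :=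
    Nat.cast_le.2 (ncard_le_ncard hOsub hfin)
  have hL2 : ((occurrences ω.A P W S).ncard : ℝ) ≤ O.ncard + w⁻¹ * volume.real Z := by
    have h1 : ((occurrences ω.A P W S).ncard : ℝ) ≤ O.ncard + G.ncard := by
      exact_mod_cast (ncard_le_ncard hsub (hOfin.union hGfin)).trans (ncard_union_le O G)
    rw [inv_mul_eq_div]
    linarith [(le_div_iff₀ hw0).2 hGcard]
  have hK1 : (f - η) * V ≤ O.ncard := by
    have h1 : (∑ t ∈ I, (ω.supertileCount P n t.2 : ℝ)) ≤ O.ncard := by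
      exact_mod_cast ω.sum_supertileCount_le hP n hId
    refine le_trans ?_ h1
    rw [hV, Finset.mul_sum]
    refine Finset.sum_le_sum fun t _ => ?_
    rw [← supertileFreq_mul]
    refine mul_le_mul_of_nonneg_right ?_ (ω.inflation_mul_volumeReal_pos n t.2).le
    linarith [(abs_le.1 (hη t.2)).1]
  have hK2 : (O.ncard : ℝ) ≤ (f + η + ε / w) * V := by
    refine (ω.ncard_patchOccurrences_le hw0 hw hP hρ n hId).trans ?_
    rw [hV, Finset.mul_sum]
    refine Finset.sum_le_sum fun t _ => ?_
    rw [← supertileFreq_mul, add_mul, div_mul_eq_mul_div]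
    refine add_le_add (mul_le_mul_of_nonneg_right ?_
      (ω.inflation_mul_volumeReal_pos n t.2).le) (div_le_div_of_nonneg_right (hε t.2) hw0.le)
    linarith [(abs_le.1 (hη t.2)).2]
  have hεw : 0 ≤ ε / w := div_nonneg hε0 hw0.le
  have hwi : 0 < w⁻¹ := inv_pos.2 hw0
  have hZ0 : 0 ≤ volume.real Z := measureReal_nonneg
  have e1 := mul_le_mul_of_nonneg_left hV1 hη0
  have e2 := mul_le_mul_of_nonneg_left hV1 hεw
  have e3 := mul_le_mul_of_nonneg_left hV1 hf0
  have e4 := mul_le_mul_of_nonneg_left hV2 hf0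
  have e5 := mul_nonneg hwi.le hZ0
  have e6 := mul_nonneg hεw (hV0.trans hV1)
  have e7 := mul_nonneg hf0 hZ0
  rw [abs_le]
  constructor <;> nlinarith

/-- A tiling that can be desubstituted arbitrarily often has uniform patch frequencies. -/
lemma hasUniformPatchFreq [Nonempty (Fin κ)] {P : Set (Tile d κ)} (hP : P.Nonempty)
    (hPfin : P.Finite) {f : ℝ} (hf : ∀ j, Tendsto (fun n => ω.supertileFreq P n j) atTop (𝓝 f))
    {S : Set (Tile d κ)} (hS : ∀ n, ∃ U, IsTiling ω.A U ∧ ω.subst^[n] U = S)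
    {F : ℕ → Set (Euc d)} (hF : IsVanHove F) : HasUniformPatchFreq ω.A F P S f := by
  obtain ⟨j₀⟩ := id ‹Nonempty (Fin κ)›
  obtain ⟨w, hw0, hw⟩ := ω.exists_volumeReal_lower_bound
  obtain ⟨ρ, hρ0, hρ⟩ := ω.exists_patchSupport_bound hPfin
  obtain ⟨ε, hε, hεb⟩ := ω.exists_boundary_bound hρ0
  have hpos := ω.inflation_mul_volumeReal_pos
  have hε0 : ∀ n, 0 ≤ ε n := fun n =>
    le_of_mul_le_mul_right (by simpa using measureReal_nonneg.trans (hεb n j₀)) (hpos n j₀)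
  have hf0 : 0 ≤ f := ge_of_tendsto' (hf j₀) fun n => div_nonneg (Nat.cast_nonneg _) (hpos n j₀).le
  obtain ⟨hFb, -, hFpos, hFlim⟩ := hF
  have hbdd : ∀ n x, Bornology.IsBounded ((fun y => x + y) '' F n) := fun n x =>
    (IsometryEquiv.addLeft x).isometry.lipschitz.isBounded_image (hFb n)
  have hvol : ∀ n, 0 < volume.real (F n) := fun n =>
    ENNReal.toReal_pos (hFpos n).ne' (hFb n).measure_lt_top.ne
  -- The layer width depends on the order `n` but not on the window, so `n` can be fixed before the
  -- windows grow. Using `D + 1` below keeps the width positive, as the van Hove condition requires.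
  have key : ∀ n, ∃ D : ℝ, 0 < D ∧ ∀ η : ℝ, 0 ≤ η → (∀ j, |ω.supertileFreq P n j - f| ≤ η) →
      ∀ W : Set (Euc d), Bornology.IsBounded W → (occurrences ω.A P W S).Finite ∧
      |((occurrences ω.A P W S).ncard : ℝ) - f * volume.real W| ≤
        (η + ε n / w) * volume.real W +
        (f + w⁻¹) * volume.real (Metric.cthickening (ρ + D) (frontier W)) := by
    intro n
    obtain ⟨U, hU, hUS⟩ := hS n
    obtain ⟨D, hD0, hD⟩ := ω.exists_supertile_bound n
    refine ⟨D + 1, by linarith, fun η hη0 hη W hW => ?_⟩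
    exact ω.window_estimate hP hU hUS hw0 hw hρ hρ0
      (fun t y hy z hz => (hD t y hy z hz).trans (by linarith)) hη0 (hε0 n) hf0 hη (hεb n) hW
  refine ⟨fun n x => ?_, ?_⟩
  · obtain ⟨D, -, hD⟩ := key 0
    exact (hD (∑ j, |ω.supertileFreq P 0 j - f|) (Finset.sum_nonneg fun j _ => abs_nonneg _)
      (fun j => Finset.single_le_sum (f := fun j => |ω.supertileFreq P 0 j - f|)
        (fun i _ => abs_nonneg _) (Finset.mem_univ j)) _ (hbdd n x)).1
  · rw [Metric.tendstoUniformly_iff]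
    intro e he
    have h1 : ∀ᶠ n in atTop, ∀ j, |ω.supertileFreq P n j - f| < e / 4 := by
      rw [eventually_all]
      intro j
      have := Metric.tendsto_nhds.1 (hf j) (e / 4) (by positivity)
      simpa only [Real.dist_eq] using this
    have h2 : ∀ᶠ n in atTop, ε n / w < e / 4 := by
      have : Tendsto (fun n => ε n / w) atTop (𝓝 0) := by simpa using hε.div_const w
      exact this.eventually (gt_mem_nhds (by positivity))
    -- Density error, crossing error and window boundary each cost less than `e / 4` of the window
    -- volume; the first two fix `n`, the third is small for large `m`, uniformly in `x`.
    obtain ⟨n, hn1, hn2⟩ := (h1.and h2).exists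
    obtain ⟨D, hD0, hD⟩ := key n
    have hlim : Tendsto (fun m => (f + w⁻¹) * (volume.real (Metric.cthickening (ρ + D)
        (frontier (F m))) / volume.real (F m))) atTop (𝓝 0) := by
      have h3 := (ENNReal.tendsto_toReal ENNReal.zero_ne_top).comp
        (hFlim (ρ + D) (by linarith))
      simpa [Function.comp_def, ENNReal.toReal_div, measureReal_def] using h3.const_mul (f + w⁻¹)
    filter_upwards [hlim.eventually (gt_mem_nhds (show 0 < e / 4 by positivity))] with m hm x
    have h4 := (hD (e / 4) (by positivity) (fun j => (hn1 j).le) _ (hbdd m x)).2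
    rw [volumeReal_add_image, cthickening_frontier_add_image, volumeReal_add_image] at h4
    have hv := hvol m
    rw [dist_comm, Real.dist_eq, div_sub' hv.ne', abs_div, abs_of_pos hv, div_lt_iff₀ hv,
      mul_comm (volume.real (F m))]
    refine h4.trans_lt ?_
    rw [← mul_div_assoc, div_lt_iff₀ hv] at hm
    nlinarith

end Windows

/-! ### Desubstitution in the tiling space. -/

section TilingSpace

/-- A tiling contains every tile that its tiles of the same type approach. -/
lemma mem_of_forall_exists_dist_lt {S : Set (Tile d κ)} (hS : InteriorsDisjoint ω.A S)
    {s : Tile d κ} (h : ∀ δ : ℝ, 0 < δ → ∃ r ∈ S, r.2 = s.2 ∧ dist r.1 s.1 < δ) : s ∈ S := by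
  obtain ⟨z, hz⟩ := ω.nonempty_interior s.2
  obtain ⟨δ, hδ, hball⟩ := Metric.isOpen_iff.1 isOpen_interior z hz
  obtain ⟨r, hr, hr2, hrd⟩ := h (δ / 2) (by positivity)
  by_cases hrs : r.1 = s.1
  · rwa [← (Prod.ext hrs hr2 : r = s)]
  -- If `r ≠ s`, a tile `r'` closer to `s` differs from `r`, yet both contain `s.1 + z` in their
  -- interiors.
  · obtain ⟨r', hr', hr2', hrd'⟩ := h (min (δ / 2) (dist r.1 s.1))
      (lt_min (by positivity) (dist_pos.2 hrs))
    have hne : r ≠ r' := fun e => absurd (hrd'.trans_le (min_le_right _ _)) (by simp [e])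
    refine absurd (hS r hr r' hr' hne) (Set.not_disjoint_iff.2 ⟨s.1 + z, ?_, ?_⟩) <;>
    rw [mem_interior_tileSupport]
    · rw [hr2]
      refine hball ?_
      rw [Metric.mem_ball, dist_eq_norm, show s.1 + z - r.1 - z = s.1 - r.1 by abel,
        ← dist_eq_norm, dist_comm]
      linarith
    · rw [hr2']
      refine hball ?_
      rw [Metric.mem_ball, dist_eq_norm, show s.1 + z - r'.1 - z = s.1 - r'.1 by abel,
        ← dist_eq_norm, dist_comm]
      linarith [min_le_left (δ / 2) (dist r.1 s.1)]

/-- The limit of a sequence of sets of tiles along an ultrafilter. -/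
def ultraLimit (𝒰 : Ultrafilter ℕ) (U : ℕ → Set (Tile d κ)) : Set (Tile d κ) :=
  {s | ∃ z : ℕ → Euc d, (∀ᶠ k in (𝒰 : Filter ℕ), (z k, s.2) ∈ U k) ∧
    Tendsto z (𝒰 : Filter ℕ) (𝓝 s.1)}

/-- For covering, the ultrafilter selects one type for the tiles over `y`, and compactness of that
prototile makes their vectors converge. For disjointness, a common interior point of two limit tiles
is interior to their approximants for most `k`, so these coincide, and so do the limits. -/
lemma isTiling_ultraLimit (𝒰 : Ultrafilter ℕ) {U : ℕ → Set (Tile d κ)}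
    (hU : ∀ k, IsTiling ω.A (U k)) : IsTiling ω.A (ultraLimit 𝒰 U) := by
  constructor
  · refine eq_univ_of_forall fun y => ?_
    have hy : ∀ k, ∃ t ∈ U k, y ∈ tileSupport ω.A t := fun k =>
      mem_patchSupport.1 ((hU k).1 ▸ mem_univ y)
    choose t ht hyt using hy
    obtain ⟨i, hi⟩ := Ultrafilter.eventually_exists_iff.1
      (Eventually.of_forall (fun k => ⟨(t k).2, rfl⟩) :
        ∀ᶠ k in (𝒰 : Filter ℕ), ∃ i, (t k).2 = i)
    obtain ⟨a, ha, hlim⟩ := (ω.isCompact i).ultrafilter_le_nhds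
      (𝒰.map fun k => y - (t k).1) (by
        rw [le_principal_iff, Ultrafilter.mem_coe, Ultrafilter.mem_map]
        filter_upwards [hi] with k hk
        have := mem_tileSupport.1 (hyt k)
        rwa [hk] at this)
    refine mem_patchSupport.2 ⟨(y - a, i), ⟨fun k => (t k).1, ?_, ?_⟩, ?_⟩
    · filter_upwards [hi] with k hk
      rw [← hk]
      exact ht k
    · have h1 : Tendsto (fun k => y - (t k).1) (𝒰 : Filter ℕ) (𝓝 a) := hlim
      simpa using (tendsto_const_nhds (x := y)).sub h1
    · rw [mem_tileSupport]
      simpa using ha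
  · rintro s ⟨z, hz, hzs⟩ t ⟨z', hz', hzt⟩ hst
    rw [Set.disjoint_left]
    intro y hys hyt
    rw [mem_interior_tileSupport] at hys hyt
    have h1 := ((tendsto_const_nhds (x := y)).sub hzs).eventually (isOpen_interior.mem_nhds hys)
    have h2 := ((tendsto_const_nhds (x := y)).sub hzt).eventually (isOpen_interior.mem_nhds hyt)
    have h3 : ∀ᶠ k in (𝒰 : Filter ℕ), z k = z' k ∧ s.2 = t.2 := by
      filter_upwards [hz, hz', h1, h2] with k k1 k2 k3 k4
      by_contra hne
      have hne' : ((z k, s.2) : Tile d κ) ≠ (z' k, t.2) := by simpa using hne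
      exact Set.disjoint_left.1 ((hU k).2 _ k1 _ k2 hne')
        (mem_interior_tileSupport.2 k3) (mem_interior_tileSupport.2 k4)
    obtain ⟨k, -, hk⟩ := h3.exists
    refine hst (Prod.ext (tendsto_nhds_unique hzs ?_) hk)
    exact hzt.congr' (h3.mono fun k hk => hk.1.symm)

/-- The bound on `ε` excludes the cap `1 / √2`, which carries no information about the tilings. -/
lemma exists_rubberSubset_of_rubberDist_lt {S₁ S₂ : Set (Tile d κ)} {ε : ℝ}
    (hε : ε ≤ 1 / Real.sqrt 2) (h : rubberDist S₁ S₂ < ε) :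
    ∃ ε', 0 < ε' ∧ ε' < ε ∧ RubberSubset ε' S₂ S₁ := by
  obtain ⟨ε', hε', hlt⟩ := exists_lt_of_csInf_lt (Set.Nonempty.inr (singleton_nonempty _)) h
  rcases hε' with ⟨h0, h1, -⟩ | h1
  · exact ⟨ε', h0, hlt, h1⟩
  · rw [mem_singleton_iff] at h1
    linarith

/-- Every member of the tiling space of a fixed point can be desubstituted arbitrarily often. -/
lemma exists_iterate_subst_eq {T S : Set (Tile d κ)} (hT : ω.IsFixedPoint T)
    (hS : S ∈ tilingSpace ω.A T) (n : ℕ) : ∃ U, IsTiling ω.A U ∧ ω.subst^[n] U = S := by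
  have hTn : ω.subst^[n] T = T := Function.iterate_fixed hT.2 n
  have hhalf : ∀ k : ℕ, 1 / ((k : ℝ) + 2) ≤ 1 / Real.sqrt 2 := by
    intro k
    refine one_div_le_one_div_of_le (by positivity) ?_
    have h1 : Real.sqrt 2 ≤ 2 := by
      rw [Real.sqrt_le_left (by norm_num)]
      norm_num
    have h2 : (0 : ℝ) ≤ k := Nat.cast_nonneg k
    linarith
  choose g hg using fun k : ℕ => hS.2 (1 / ((k : ℝ) + 2)) (by positivity)
  choose e he0 he hrub using fun k => exists_rubberSubset_of_rubberDist_lt (hhalf k) (hg k)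
  -- Since `ω^n(T) = T`, the translates `T - g k` approaching `S` are `ω^n` of the translates by
  -- `Q^{-n} (g k)`; a limit of the latter is the desired preimage.
  set U : ℕ → Set (Tile d κ) := fun k => translateTiles (-(ω.powEquiv n).symm (g k)) T with hU
  have hUk : ∀ k, ω.subst^[n] (U k) = translateTiles (-g k) T := by
    intro k
    rw [hU, iterate_subst_translateTiles, hTn, map_neg, ContinuousLinearEquiv.apply_symm_apply]
  let 𝒰 : Ultrafilter ℕ := hyperfilter ℕ
  have h𝒰 : (𝒰 : Filter ℕ) ≤ atTop := Nat.hyperfilter_le_atTop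
  have hlim := ω.isTiling_ultraLimit 𝒰 fun k => hT.1.translateTiles (-(ω.powEquiv n).symm (g k))
  -- One inclusion suffices, as a tiling contained in another equals it.
  refine ⟨_, hlim, ω.eq_of_isTiling_subset (ω.isTiling_iterate_subst n hlim) hS.1 ?_⟩
  intro s hs
  obtain ⟨t, ⟨z, hz, hzt⟩, hst⟩ := ω.mem_iterate_subst.1 hs
  rw [iterate_subst_singleton, mem_translateTiles] at hst
  set u := s.1 - ω.powEquiv n t.1 with hu
  have hmem : ∀ᶠ k in (𝒰 : Filter ℕ), (ω.powEquiv n (z k) + u, s.2) ∈ translateTiles (-g k) T := by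
    filter_upwards [hz] with k hk
    rw [← hUk, mem_iterate_subst]
    refine ⟨_, hk, ?_⟩
    rw [iterate_subst_singleton, mem_translateTiles]
    simpa using hst
  have hconv : Tendsto (fun k => ω.powEquiv n (z k) + u) (𝒰 : Filter ℕ) (𝓝 s.1) := by
    have h1 := (((ω.powEquiv n).continuous.tendsto t.1).comp hzt).add_const u
    have h2 : ω.powEquiv n t.1 + u = s.1 := by simp [hu]
    rwa [h2] at h1
  have hinv : Tendsto (fun k : ℕ => 1 / ((k : ℝ) + 2)) atTop (𝓝 0) :=
    tendsto_const_nhds.div_atTop (tendsto_natCast_atTop_atTop.atTop_add tendsto_const_nhds)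
  refine ω.mem_of_forall_exists_dist_lt hS.1.2 fun δ hδ => ?_
  have h1 : ∀ᶠ k in (𝒰 : Filter ℕ), dist (ω.powEquiv n (z k) + u) s.1 < min (δ / 2) 1 :=
    Metric.tendsto_nhds.1 hconv _ (by positivity)
  have h2 : ∀ᶠ k : ℕ in (𝒰 : Filter ℕ), 1 / ((k : ℝ) + 2) < δ / 2 :=
    h𝒰 (hinv.eventually (gt_mem_nhds (by positivity)))
  have h3 : ∀ᶠ k : ℕ in (𝒰 : Filter ℕ), ‖s.1‖ + 1 < (k : ℝ) + 2 := by
    refine h𝒰 ?_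
    filter_upwards [tendsto_natCast_atTop_atTop.eventually_gt_atTop (‖s.1‖ + 1)] with k hk
    linarith
  obtain ⟨k, k1, k2, k3, k4⟩ := (hmem.and (h1.and (h2.and h3))).exists
  have hk := le_min_iff.1 k2.le
  -- The rubber comparison only reaches radius `1 / e k`, which exceeds `k + 2` and hence the norm
  -- of the approximating vector.
  obtain ⟨r, hr, hr2, hrd⟩ := hrub k _ k1 (by
    have h4 : (k : ℝ) + 2 < 1 / e k := by
      rw [lt_one_div (by positivity) (he0 k)]
      exact he k
    have h5 : ‖ω.powEquiv n (z k) + u‖ ≤ ‖s.1‖ + dist (ω.powEquiv n (z k) + u) s.1 := by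
      rw [dist_eq_norm]
      exact norm_le_norm_add_norm_sub' _ _
    simp only
    linarith [hk.2])
  refine ⟨r, hr, hr2, ?_⟩
  have h6 : dist (ω.powEquiv n (z k) + u) r.1 < e k := hrd
  have h7 := dist_triangle_left r.1 s.1 (ω.powEquiv n (z k) + u)
  have := k2.trans_le (min_le_left _ _)
  linarith [he k]

end TilingSpace

end TileSubstitution

/-! ### The main theorem. -/

theorem mainTheorem11 {d κ : ℕ} (ω : TileSubstitution d κ) (hω : ω.IsPrimitive)
    (T : Set (Tile d κ)) (hT : ω.IsFixedPoint T) :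
    (∀ P : Set (Tile d κ), P.Nonempty → ω.IsLegal P →
      ∃ c : ℝ, 0 < c ∧
        (∀ F : ℕ → Set (Euc d), IsVanHove F → HasUniformPatchFreq ω.A F P T c) ∧
        (∀ S ∈ tilingSpace ω.A T, ∀ F : ℕ → Set (Euc d), IsVanHove F →
          HasUniformPatchFreq ω.A F P S c)) ∧
    (∀ P : Set (Tile d κ), P.Nonempty → IsPatch ω.A P → ¬ ω.IsLegal P →
      ∀ S ∈ tilingSpace ω.A T, ∀ F : ℕ → Set (Euc d), IsVanHove F →
        HasUniformPatchFreq ω.A F P S 0) ∧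
    (∀ P : Set (Tile d κ), P.Nonempty → ω.IsAdmittedInLimit P →
      ∀ S ∈ tilingSpace ω.A T, ∀ F : ℕ → Set (Euc d), IsVanHove F →
        HasUniformPatchFreq ω.A F P S 0) := by
  obtain ⟨y, hy⟩ : ∃ y : Euc d, y ∈ patchSupport ω.A T := ⟨0, hT.1.1 ▸ mem_univ _⟩
  obtain ⟨t, -, -⟩ := mem_patchSupport.1 hy
  have : Nonempty (Fin κ) := ⟨t.2⟩
  have hnonlegal : ∀ P : Set (Tile d κ), P.Nonempty → IsPatch ω.A P → ¬ ω.IsLegal P →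
      ∀ S ∈ tilingSpace ω.A T, ∀ F : ℕ → Set (Euc d), IsVanHove F →
        HasUniformPatchFreq ω.A F P S 0 := by
    intro P hP hPp hL S hS F hF
    refine ω.hasUniformPatchFreq hP hPp.1 (fun j => ?_) (ω.exists_iterate_subst_eq hT hS) hF
    simp [TileSubstitution.supertileFreq, ω.supertileCount_eq_zero hL]
  refine ⟨fun P hP hL => ?_, hnonlegal, fun P hP hA => hnonlegal P hP hA.1 hA.2.1⟩
  have hPfin := ω.finite_of_isLegal hL
  obtain ⟨c, hc, hpos⟩ := ω.exists_supertileFreq_limit hω hP hPfin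
  refine ⟨c, hpos hL, fun F hF => ?_, fun S hS F hF => ?_⟩
  · exact ω.hasUniformPatchFreq hP hPfin hc
      -- The fixed point is its own desubstitution at every order.
      (fun n => ⟨T, hT.1, Function.iterate_fixed hT.2 n⟩) hF
  · exact ω.hasUniformPatchFreq hP hPfin hc (ω.exists_iterate_subst_eq hT hS) hF
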